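/- **Setting.** Let $F\in C^1(\mathbb R^n\times\mathbb R^m;\mathbb R^n)$ with $F(0,0)=0$ and, for some $L_F>0$, $\|F(x_1,u_1)-F(x_2,u_2)\|\le L_F(\|x_1-x_2\|+\|u_1-u_2\|)$ for all $x_i,u_i$ (Euclidean norms). For $T\ge 0$ let $\mathcal U_T$ be the set of essentially bounded measurable inputs $\tilde u:[0,T]\to\mathbb R^m$; for $x_0\in\mathbb R^n$ the system trajectory $(\tilde x,\tilde u)$ is given by the absolutely continuous solution of $\dot{\tilde x}=F(\tilde x,\tilde u)$, $\tilde x(0)=x_0$ on $[0,T]$. Let $$J_T(\tilde u;x_0)=\int_0^T \big(Q(\tilde x(t))+R(\tilde u(t))\big)\,dt+V(\tilde x(T)),$$ where $Q,V:\mathbb R^n\to\mathbb R$ and $R:\mathbb R^m\to\mathbb R$ are $C^2$, vanish together with their gradients at the origin, and satisfy $\alpha_Q I\preceq\nabla^2Q\preceq\beta_Q I$, $\alpha_R I\preceq\nabla^2R\preceq\beta_R I$, $\alpha_V I\preceq\nabla^2V\preceq\beta_V I$ everywhere, with $0<\alpha_Q\le\beta_Q$, $0<\alpha_R\le\beta_R$,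 $0\le\alpha_V\le\beta_V$. An input $\tilde u\in\mathcal U_T$ is an $\epsilon$-first-order stationary point ($\epsilon$-FOS) of $J_T(\cdot;x_0)$ if $\|\nabla J_T(\tilde u;x_0)\|_{L^2([0,T])}\le\epsilon$, where the gradient $\nabla J_T(\tilde u;x_0)\in L^2([0,T];\mathbb R^m)$ represents the directional derivatives of $J_T(\cdot;x_0)$ at $\tilde u$ in all directions of $\mathcal U_T$ through the $L^2$ inner product. Along a system trajectory $(\tilde x,\tilde u)$ on $[0,T]$ put $\tilde A(t)=\partial_xF(\tilde x(t),\tilde u(t))$, $\tilde B(t)=\partial_uF(\tilde x(t),\tilde u(t))$ and $\tilde d(t)=F(\tilde x(t),\tilde u(t))-\tilde A(t)\tilde x(t)-\tilde B(t)\tilde u(t)$; let $\tilde B^\dagger$ be the Moore–Penrose pseudoinverse. A linear system $(A(\cdot),B(\cdot))$ on $[0,T]$ is *$\gamma$-stabilizable* if for all $s\in[0,T]$ and $\xi\in\mathbb R^n$ $$\inf_{\hat u}\ \int_s^T\big(\|\hat x(t)\|^2+\|\hat u(t)\|^2\big)\,dt+\|\hat x(T)\|^2\le\gamma\|\xi\|^2,\qquad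 \dot{\hat x}=A\hat x+B\hat u,\ \hat x(s)=\xi,$$ the infimum being over essentially bounded measurable $\hat u:[s,T]\to\mathbb R^m$. **Theorem.** Let $\gamma,L_x,L_u>0$ and suppose that for every $T\ge0$, $x_0\in\mathbb R^n$ and $\tilde u\in\mathcal U_T$, along the resulting trajectory, (i) $\tilde d(t)\in\mathrm{range}(\tilde B(t))$ for all $t\in[0,T]$; (ii) $(\tilde A(\cdot),\tilde B(\cdot))$ is $\gamma$-stabilizable; (iii) $\|\tilde B^\dagger(t)\tilde d(t)\|\le L_x\|\tilde x(t)\|+L_u\|\tilde u(t)\|$ for all $t\in[0,T]$; and suppose that (iv) $L_u^2\le\frac{\alpha_R}{8\beta_R}$ and $L_x^2\le\frac{\alpha_Q}{8\beta_R}$. Set $$\mathcal C_0=6L_F+\tfrac{2L_F\alpha_Q}{\alpha_R}+\tfrac{2\alpha_Q}{\alpha_V},\quad \mathcal C_1=\tfrac{4\gamma}{\alpha_Q}\max\{\beta_V,\beta_R,\beta_Q\},\quad \mathcal C_2=\tfrac{1}{2\alpha_Q\alpha_R}\Big(1+8\beta_R\max\big\{\tfrac{L_x^2}{\alpha_Q},\tfrac{L_u^2}{\alpha_R}\big\}\Big),$$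 $$\mathcal C_0^\delta=6L_F+\tfrac{2L_F\alpha_Q}{\alpha_R}+\min\big\{\tfrac2\delta,\tfrac{2\alpha_Q}{\alpha_R}\big\},\qquad \mathcal C_1^\delta=e^{\delta/\mathcal C_1}\mathcal C_1 .$$ Then for every $T\ge0$, $x_0\in\mathbb R^n$, $\epsilon$, and every $\tilde u\in\mathcal U_T$ that is an $\epsilon$-FOS of $J_T(\cdot;x_0)$, with trajectory $\tilde x$: 1. if $\alpha_V>0$, then for all $s\in[0,T]$: $\ \|\tilde x(s)\|^2\le\mathcal C_0\big(\mathcal C_1e^{-s/\mathcal C_1}\|x_0\|^2+\mathcal C_2\epsilon^2\big)$; 2. for any $\alpha_V\ge0$, for all $s\in[0,T]$ and all $\delta>0$: $\ \|\tilde x(s)\|^2\le\mathcal C_0^\delta\big(\mathcal C_1^\delta e^{-s/\mathcal C_1}\|x_0\|^2+\mathcal C_2\epsilon^2\big)$. -/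

import Mathlib

open MeasureTheory Set
open scoped ENNReal

noncomputable section

/-- The state (or input) space: `ℝᵏ` with the Euclidean norm. -/
abbrev Euc (k : ℕ) : Type := EuclideanSpace ℝ (Fin k)

/-! ### Moore–Penrose pseudoinverse -/

/-- `B` restricted to a map from the orthogonal complement of its kernel to its range. -/
def coreMap {n m : ℕ} (B : Euc m →L[ℝ] Euc n) :
    (LinearMap.ker B.toLinearMap)ᗮ →ₗ[ℝ] LinearMap.range B.toLinearMap :=
  B.toLinearMap.rangeRestrict.comp (LinearMap.ker B.toLinearMap)ᗮ.subtype

theorem coreMap_bijective {n m : ℕ} (B : Euc m →L[ℝ] Euc n) :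
    Function.Bijective (coreMap B) := by
  constructor
  · rw [← LinearMap.ker_eq_bot, LinearMap.ker_eq_bot']
    rintro ⟨v, hv⟩ h
    have h1 : B v = 0 := congrArg Subtype.val h
    have h2 : v ∈ LinearMap.ker B.toLinearMap := h1
    have h3 : inner ℝ v v = (0 : ℝ) := (Submodule.mem_orthogonal _ v).1 hv v h2
    exact Subtype.ext (inner_self_eq_zero.1 h3)
  · rintro ⟨y, v, rfl⟩
    refine ⟨(LinearMap.ker B.toLinearMap)ᗮ.orthogonalProjectionOnto v, Subtype.ext ?_⟩
    have h1 : v - (LinearMap.ker B.toLinearMap)ᗮ.orthogonalProjectionOnto v ∈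
        (LinearMap.ker B.toLinearMap)ᗮᗮ :=
      Submodule.sub_starProjection_mem_orthogonal v
    rw [Submodule.orthogonal_orthogonal] at h1
    have h2 : B (v - (LinearMap.ker B.toLinearMap)ᗮ.orthogonalProjectionOnto v) = 0 := h1
    rw [map_sub, sub_eq_zero] at h2
    exact h2.symm

/-- The Moore–Penrose pseudoinverse `B†`: project orthogonally onto `range B`, then invert
the bijection `(ker B)ᗮ → range B`. -/
def pinv {n m : ℕ} (B : Euc m →L[ℝ] Euc n) : Euc n →ₗ[ℝ] Euc m :=
  (LinearMap.ker B.toLinearMap)ᗮ.subtype ∘ₗ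
    (LinearEquiv.ofBijective (coreMap B) (coreMap_bijective B)).symm.toLinearMap ∘ₗ
      (LinearMap.range B.toLinearMap).orthogonalProjectionOnto.toLinearMap

/-! ### Inputs, trajectories and linearizations -/

/-- Admissible inputs on `[a, b]`: measurable and essentially bounded
(hence also square integrable). -/
def AdmissibleInput {m : ℕ} (a b : ℝ) (u : ℝ → Euc m) : Prop :=
  MemLp u ∞ (volume.restrict (Icc a b))

/-- `x` is a (Carathéodory) solution on `[a, b]` of `ẋ(t) = f(t, x(t))`, `x(a) = ξ`. -/
structure IsSolution {n : ℕ} (f : ℝ → Euc n → Euc n) (a b : ℝ) (ξ : Euc n)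
    (x : ℝ → Euc n) : Prop where
  continuousOn : ContinuousOn x (Icc a b)
  integrable : IntervalIntegrable (fun τ => f τ (x τ)) volume a b
  eq_integral : ∀ t ∈ Icc a b, x t = ξ + ∫ τ in a..t, f τ (x τ)

/-- `x` is the state trajectory on `[0, T]` of `ẋ = F(x, u)`, `x(0) = x₀`. -/
def IsTrajectory {n m : ℕ} (F : Euc n × Euc m → Euc n) (T : ℝ) (x₀ : Euc n)
    (u : ℝ → Euc m) (x : ℝ → Euc n) : Prop :=
  IsSolution (fun τ y => F (y, u τ)) 0 T x₀ x

/-- `Ã = ∂F/∂x` at `(x, u)`. -/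
def jacA {n m : ℕ} (F : Euc n × Euc m → Euc n) (x : Euc n) (u : Euc m) : Euc n →L[ℝ] Euc n :=
  fderiv ℝ (fun y => F (y, u)) x

/-- `B̃ = ∂F/∂u` at `(x, u)`. -/
def jacB {n m : ℕ} (F : Euc n × Euc m → Euc n) (x : Euc n) (u : Euc m) : Euc m →L[ℝ] Euc n :=
  fderiv ℝ (fun v => F (x, v)) u

/-- The drift `d̃ = F(x, u) - Ã x - B̃ u`. -/
def drift {n m : ℕ} (F : Euc n × Euc m → Euc n) (x : Euc n) (u : Euc m) : Euc n :=
  F (x, u) - jacA F x u x - jacB F x u u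

/-- `γ`-stabilizability of the linear time-varying system `(A(·), B(·))` on `[0, T]`.
The infimum is taken in `EReal`, over admissible inputs `v` and the trajectories `z` they
generate from `z(s) = ξ`. -/
def IsStabilizable {n m : ℕ} (γ T : ℝ) (A : ℝ → Euc n →L[ℝ] Euc n)
    (B : ℝ → Euc m →L[ℝ] Euc n) : Prop :=
  ∀ s ∈ Icc 0 T, ∀ ξ : Euc n,
    (⨅ (v : ℝ → Euc m) (z : ℝ → Euc n) (_ : AdmissibleInput s T v)
        (_ : IsSolution (fun τ y => A τ y + B τ (v τ)) s T ξ z),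
      (((∫ t in s..T, (‖z t‖ ^ 2 + ‖v t‖ ^ 2)) + ‖z T‖ ^ 2 : ℝ) : EReal))
    ≤ ((γ * ‖ξ‖ ^ 2 : ℝ) : EReal)

/-! ### Costs and stationary points -/

/-- `ℓ` is `C²`, is minimized at the origin with value `0`, and `α I ⪯ ∇²ℓ ⪯ β I`. -/
structure IsCost {k : ℕ} (α β : ℝ) (ℓ : Euc k → ℝ) : Prop where
  contDiff : ContDiff ℝ 2 ℓ
  map_zero : ℓ 0 = 0
  fderiv_zero : fderiv ℝ ℓ 0 = 0
  le_hessian : ∀ x v, α * ‖v‖ ^ 2 ≤ fderiv ℝ (fderiv ℝ ℓ) x v v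
  hessian_le : ∀ x v, fderiv ℝ (fderiv ℝ ℓ) x v v ≤ β * ‖v‖ ^ 2

open Classical in
/-- The state trajectory on `[0, T]` generated by the input `u` from `x₀` (determined on `[0, T]`
when `F` is globally Lipschitz and `u` is admissible; the default value is then never used). -/
def stateTraj {n m : ℕ} (F : Euc n × Euc m → Euc n) (T : ℝ) (x₀ : Euc n)
    (u : ℝ → Euc m) : ℝ → Euc n :=
  if h : ∃ x, IsTrajectory F T x₀ u x then h.choose else 0

/-- `J_T(u; x₀) = ∫₀ᵀ (Q(x(t)) + R(u(t))) dt + V(x(T))`. -/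
def cost {n m : ℕ} (F : Euc n × Euc m → Euc n) (Q : Euc n → ℝ) (R : Euc m → ℝ)
    (V : Euc n → ℝ) (T : ℝ) (x₀ : Euc n) (u : ℝ → Euc m) : ℝ :=
  (∫ t in (0 : ℝ)..T, (Q (stateTraj F T x₀ u t) + R (u t))) + V (stateTraj F T x₀ u T)

/-- `g` is the `L²([0, T])`-gradient at `u` of the functional `J` on admissible inputs. -/
structure IsL2Gradient {m : ℕ} (T : ℝ) (J : (ℝ → Euc m) → ℝ) (u g : ℝ → Euc m) : Prop where
  memLp : MemLp g 2 (volume.restrict (Icc 0 T))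
  hasDerivAt : ∀ h : ℝ → Euc m, AdmissibleInput 0 T h →
    HasDerivAt (fun η : ℝ => J (u + η • h)) (∫ t in (0 : ℝ)..T, inner ℝ (g t) (h t)) 0

/-- `u` is an `ε`-approximate first-order stationary point of `J`: `‖∇J(u)‖_{L²} ≤ ε`. -/
def IsFOS {m : ℕ} (T ε : ℝ) (J : (ℝ → Euc m) → ℝ) (u : ℝ → Euc m) : Prop :=
  AdmissibleInput 0 T u ∧
    ∃ g, IsL2Gradient T J u g ∧ (eLpNorm g 2 (volume.restrict (Icc 0 T))).toReal ≤ ε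

/-! ### The constants of the bound -/

def constC0 (LF αQ αR αV : ℝ) : ℝ := 6 * LF + 2 * LF * αQ / αR + 2 * αQ / αV

def constC0δ (LF αQ αR δ : ℝ) : ℝ := 6 * LF + 2 * LF * αQ / αR + min (2 / δ) (2 * αQ / αR)

def constC1 (γ αQ βQ βR βV : ℝ) : ℝ := 4 * γ * max βV (max βR βQ) / αQ

def constC2 (αQ αR βR Lx Lu : ℝ) : ℝ :=
  1 / (2 * αR * αQ) * (1 + 8 * βR * max (Lx ^ 2 / αQ) (Lu ^ 2 / αR))

end

/- Let `w = ‖x‖² + (αR / αQ) ‖u‖²` be the energy density along an `ε`-stationary `u`. The gradient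
condition is a first variation along the linearized system, so by convexity of the costs `u` is,
up to an error of order `ε²`, at least as good on every `[s, T]` as each linearized trajectory
issued from `x s`. The matching condition cancels the drift of the linearization by an input of
size at most `Lx ‖x‖ + Lu ‖u‖`, and stabilizability then supplies a competitor of cost
`O(γ ‖x s‖²)`. The smallness of `Lx` and `Lu` lets the cost of the cancelling input be absorbed,
which leaves `∫_s^T w + (αV / αQ) ‖x T‖² ≤ C₁ ‖x s‖² + 2 C₂ ε²` for every `s`.

Since `‖x‖² ≤ w`, Grönwall's inequality turns this into exponential decay of the tail integral. To
return to `‖x s‖²` one uses that its increments are bounded by a multiple of `∫ w`, comparing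
`‖x s‖²` with `‖x T‖²` when `αV > 0`, and with its average over a window of length `δ` or
`αR / αQ` otherwise. At times shorter than the window the bound is that of the initial state, which
needs lower bounds on `C₁`: stabilizability forces `γ ≥ 1` when `n > 0`, and at the equilibrium it
forces `γ ≥ 3 / (16 LF)`, a state of norm `‖ξ‖` taking a time of order `1 / LF` to decay. -/

open Filter Topology

/-! ### Costs with bounded Hessian -/

theorem add_deriv_add_half_le_of_le_deriv2 {φ φ' φ'' : ℝ → ℝ} {c : ℝ}
    (hφ : ∀ t, HasDerivAt φ (φ' t) t) (hφ' : ∀ t, HasDerivAt φ' (φ'' t) t)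
    (hc : ∀ t, c ≤ φ'' t) : φ 0 + φ' 0 + c / 2 ≤ φ 1 := by
  have hψ : ∀ t, HasDerivAt (fun t => φ t - c / 2 * t ^ 2) (φ' t - c * t) t := fun t => by
    convert! (hφ t).sub ((hasDerivAt_pow 2 t).const_mul (c / 2)) using 1
    norm_num
    ring
  have hmono : Monotone (deriv fun t => φ t - c / 2 * t ^ 2) := by
    rw [show deriv (fun t => φ t - c / 2 * t ^ 2) = fun t => φ' t - c * t from
      funext fun t => (hψ t).deriv]
    refine monotone_of_hasDerivAt_nonneg
      (fun t => (hφ' t).sub ((hasDerivAt_id t).const_mul c)) fun t => ?_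
    simpa using hc t
  have hconv := hmono.convexOn_univ_of_deriv fun t => (hψ t).differentiableAt
  have hslope := hconv.le_slope_of_hasDerivAt (mem_univ 0) (mem_univ 1) one_pos (hψ 0)
  simp only [slope_def_field] at hslope
  norm_num at hslope
  linarith

namespace IsCost

variable {k : ℕ} {α β : ℝ} {ℓ : Euc k → ℝ}

theorem contDiff_one (h : IsCost α β ℓ) : ContDiff ℝ 1 ℓ :=
  h.contDiff.of_le (by norm_num)

theorem hasFDerivAt (h : IsCost α β ℓ) (x : Euc k) : HasFDerivAt ℓ (fderiv ℝ ℓ x) x :=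
  (h.contDiff_one.differentiable one_ne_zero x).hasFDerivAt

theorem hasDerivAt_line (h : IsCost α β ℓ) (x v : Euc k) (t : ℝ) :
    HasDerivAt (fun t : ℝ => ℓ (x + t • v)) (fderiv ℝ ℓ (x + t • v) v) t :=
  (h.hasFDerivAt _).comp_hasDerivAt t
    (by simpa using ((hasDerivAt_id t).smul_const v).const_add x)

theorem hasDerivAt_fderiv_line (h : IsCost α β ℓ) (x v : Euc k) (t : ℝ) :
    HasDerivAt (fun t : ℝ => fderiv ℝ ℓ (x + t • v) v)
      (fderiv ℝ (fderiv ℝ ℓ) (x + t • v) v v) t := by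
  have hℓ' : Differentiable ℝ (fderiv ℝ ℓ) :=
    (h.contDiff.fderiv_right (m := 1) (by norm_num)).differentiable one_ne_zero
  simpa using ((hℓ' _).hasFDerivAt.comp_hasDerivAt t
    (by simpa using ((hasDerivAt_id t).smul_const v).const_add x)).clm_apply (hasDerivAt_const t v)

theorem add_fderiv_add_le (h : IsCost α β ℓ) (x y : Euc k) :
    ℓ x + fderiv ℝ ℓ x (y - x) + α / 2 * ‖y - x‖ ^ 2 ≤ ℓ y := by
  have := add_deriv_add_half_le_of_le_deriv2 (h.hasDerivAt_line x (y - x))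
    (h.hasDerivAt_fderiv_line x (y - x)) fun t => h.le_hessian _ _
  simp only [zero_smul, add_zero, one_smul, add_sub_cancel] at this
  linarith

theorem add_fderiv_le (h : IsCost α β ℓ) (hα : 0 ≤ α) (x y : Euc k) :
    ℓ x + fderiv ℝ ℓ x (y - x) ≤ ℓ y :=
  (le_add_of_nonneg_right (by positivity)).trans (h.add_fderiv_add_le x y)

theorem half_mul_norm_sq_le (h : IsCost α β ℓ) (y : Euc k) : α / 2 * ‖y‖ ^ 2 ≤ ℓ y := by
  simpa [h.map_zero, h.fderiv_zero] using h.add_fderiv_add_le 0 y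

theorem le_half_mul_norm_sq (h : IsCost α β ℓ) (y : Euc k) : ℓ y ≤ β / 2 * ‖y‖ ^ 2 := by
  have := add_deriv_add_half_le_of_le_deriv2 (fun t => (h.hasDerivAt_line 0 y t).neg)
    (fun t => (h.hasDerivAt_fderiv_line 0 y t).neg) fun t => neg_le_neg (h.hessian_le _ _)
  simp only [Pi.neg_apply, zero_smul, add_zero, one_smul, zero_add, h.map_zero, h.fderiv_zero,
    _root_.zero_apply] at this
  linarith

end IsCost

/-! ### Integral inequalities on an interval -/

section Interval

variable {E : Type*} [NormedAddCommGroup E] {a b s t : ℝ}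

theorem intervalIntegrable_of_integrableOn_Icc {f : ℝ → E} (hf : IntegrableOn f (Icc a b))
    (hs : s ∈ Icc a b) (ht : t ∈ Icc a b) : IntervalIntegrable f volume s t :=
  (hf.mono_set (ordConnected_Icc.uIcc_subset hs ht)).intervalIntegrable

theorem intervalIntegrable_of_memLp_top {f : ℝ → E} (hf : MemLp f ∞ (volume.restrict (Icc a b)))
    (hs : s ∈ Icc a b) (ht : t ∈ Icc a b) : IntervalIntegrable f volume s t :=
  intervalIntegrable_of_integrableOn_Icc (hf.integrable le_top) hs ht

theorem integrableOn_Icc_of_intervalIntegrable {f : ℝ → E} (hab : a ≤ b)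
    (hf : IntervalIntegrable f volume a b) : IntegrableOn f (Icc a b) :=
  (intervalIntegrable_iff_integrableOn_Icc_of_le hab).1 hf

theorem hasDerivWithinAt_integral_Icc [NormedSpace ℝ E] [CompleteSpace E] {φ : ℝ → E}
    (hφ : ContinuousOn φ (Icc a b)) (ht : t ∈ Icc a b) :
    HasDerivWithinAt (fun t => ∫ τ in a..t, φ τ) (φ t) (Icc a b) t := by
  have : Fact (t ∈ Icc a b) := ⟨ht⟩
  exact intervalIntegral.integral_hasDerivWithinAt_right
    (intervalIntegrable_of_integrableOn_Icc hφ.integrableOn_Icc ⟨le_rfl, ht.1.trans ht.2⟩ ht)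
    (hφ.stronglyMeasurableAtFilter_nhdsWithin measurableSet_Icc t) (hφ t ht)

theorem integral_mono_interval_Icc {w : ℝ → ℝ} (hw : IntegrableOn w (Icc a b))
    (h0 : 0 ≤ᵐ[volume.restrict (Icc a b)] w) {c d : ℝ} (hac : a ≤ c) (hcs : c ≤ s) (hst : s ≤ t)
    (htd : t ≤ d) (hdb : d ≤ b) : ∫ τ in s..t, w τ ≤ ∫ τ in c..d, w τ :=
  intervalIntegral.integral_mono_interval hcs hst htd
    (ae_restrict_of_ae_restrict_of_subset
      (Ioc_subset_Icc_self.trans (Icc_subset_Icc hac hdb)) h0)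
    (intervalIntegrable_of_integrableOn_Icc hw ⟨hac, by linarith⟩ ⟨by linarith, hdb⟩)

theorem le_mul_exp_of_le_add_mul_integral {φ : ℝ → ℝ} {c L : ℝ} (hL : 0 ≤ L)
    (hφ : ContinuousOn φ (Icc a b)) (h : ∀ t ∈ Icc a b, φ t ≤ c + L * ∫ τ in a..t, φ τ)
    (ht : t ∈ Icc a b) : φ t ≤ c * Real.exp (L * (t - a)) := by
  have hderiv : ∀ t ∈ Icc a b,
      HasDerivWithinAt (fun t => c + L * ∫ τ in a..t, φ τ) (L * φ t) (Icc a b) t := fun t ht =>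
    ((hasDerivWithinAt_integral_Icc hφ ht).const_mul L).const_add c
  refine (h t ht).trans ?_
  rw [← gronwallBound_ε0]
  refine le_gronwallBound_of_liminf_deriv_right_le (f' := fun t => L * φ t)
    (fun t ht => (hderiv t ht).continuousWithinAt) (fun t ht r hr => ?_) (by simp)
    (fun t ht => ?_) t ht
  · have hIci := (hderiv t (Ico_subset_Icc_self ht)).mono_of_mem_nhdsWithin
      (Icc_mem_nhdsGE_of_mem ht)
    simpa only [slope_def_module, smul_eq_mul] using hIci.liminf_right_slope_le hr
  · simpa using mul_le_mul_of_nonneg_left (h t (Ico_subset_Icc_self ht)) hL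

theorem mul_exp_le_of_add_mul_integral_le {Y : ℝ → ℝ} {L : ℝ} (hL : 0 ≤ L) (hab : a ≤ b)
    (hY : ContinuousOn Y (Icc a b)) (h : ∀ s ∈ Icc a b, Y b + L * ∫ τ in s..b, Y τ ≤ Y s) :
    Y b * Real.exp (L * (b - a)) ≤ Y a := by
  have hmaps : ∀ s ∈ Icc a b, a + b - s ∈ Icc a b := fun s hs =>
    ⟨by linarith [hs.2], by linarith [hs.1]⟩
  have hreflect := le_mul_exp_of_le_add_mul_integral (φ := fun s => -Y (a + b - s)) (c := -Y b) hL
    (hY.comp (by fun_prop) hmaps).neg (fun s hs => by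
      have := h (a + b - s) (hmaps s hs)
      rw [intervalIntegral.integral_neg, intervalIntegral.integral_comp_sub_left Y (a + b),
        add_sub_cancel_left]
      linarith) (right_mem_Icc.2 hab)
  simp only [add_sub_cancel_right] at hreflect
  linarith

theorem norm_le_integral_mul_exp [NormedSpace ℝ E] {L : ℝ} (hL : 0 ≤ L) {r k : ℝ → E} {e : ℝ → ℝ}
    (hr : ContinuousOn r (Icc a b)) (he : IntegrableOn e (Icc a b))
    (he0 : 0 ≤ᵐ[volume.restrict (Icc a b)] e) (hrk : ∀ t ∈ Icc a b, r t = ∫ τ in a..t, k τ)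
    (hk : ∀ᵐ t ∂volume.restrict (Icc a b), ‖k t‖ ≤ L * ‖r t‖ + e t) (ht : t ∈ Icc a b) :
    ‖r t‖ ≤ (∫ τ in a..b, e τ) * Real.exp (L * (t - a)) := by
  refine le_mul_exp_of_le_add_mul_integral (φ := fun t => ‖r t‖) hL hr.norm (fun t ht => ?_) ht
  have ha : a ∈ Icc a b := ⟨le_rfl, ht.1.trans ht.2⟩
  have hri := (intervalIntegrable_of_integrableOn_Icc hr.norm.integrableOn_Icc ha ht).const_mul L
  have hei := intervalIntegrable_of_integrableOn_Icc he ha ht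
  calc ‖r t‖ ≤ ∫ τ in a..t, (L * ‖r τ‖ + e τ) := by
        rw [hrk t ht]
        refine intervalIntegral.norm_integral_le_of_norm_le ht.1 ?_ (hri.add hei)
        filter_upwards [ae_imp_of_ae_restrict hk] with τ hτ hτt
        exact hτ ⟨hτt.1.le, hτt.2.trans ht.2⟩
    _ = (∫ τ in a..t, e τ) + L * ∫ τ in a..t, ‖r τ‖ := by
        rw [intervalIntegral.integral_add hri hei, intervalIntegral.integral_const_mul, add_comm]
    _ ≤ _ := by
        gcongr
        exact integral_mono_interval_Icc he he0 le_rfl le_rfl ht.1 ht.2 le_rfl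

end Interval

/-! ### The energy identity -/

theorem absolutelyContinuousOnInterval_of_dist_le {X Y : Type*} [PseudoMetricSpace X]
    [PseudoMetricSpace Y] {f : ℝ → X} {g : ℝ → Y} {a b : ℝ}
    (hg : AbsolutelyContinuousOnInterval g a b)
    (h : ∀ s ∈ uIcc a b, ∀ t ∈ uIcc a b, dist (f s) (f t) ≤ dist (g s) (g t)) :
    AbsolutelyContinuousOnInterval f a b := by
  refine squeeze_zero' (Eventually.of_forall fun I => Finset.sum_nonneg fun _ _ => dist_nonneg)
    (eventually_inf_principal.2 (Eventually.of_forall fun I hI => ?_)) hg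
  exact Finset.sum_le_sum fun i hi => h _ (hI.1 i hi).1 _ (hI.1 i hi).2

theorem absolutelyContinuousOnInterval_norm_sq_integral {E : Type*} [NormedAddCommGroup E]
    [NormedSpace ℝ E] {f : ℝ → E} {a b : ℝ}
    (hf : IntervalIntegrable f volume a b) (ξ : E) :
    AbsolutelyContinuousOnInterval (fun t => ‖ξ + ∫ τ in a..t, f τ‖ ^ 2) a b := by
  obtain ⟨M, hM⟩ : ∃ M, ∀ t ∈ uIcc a b, ‖ξ + ∫ τ in a..t, f τ‖ ≤ M :=
    isCompact_uIcc.exists_bound_of_continuousOn (continuousOn_const.add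
      (intervalIntegral.continuousOn_primitive_interval' hf left_mem_uIcc))
  refine absolutelyContinuousOnInterval_of_dist_le
    ((hf.norm.absolutelyContinuousOnInterval_intervalIntegral left_mem_uIcc).const_mul (2 * M))
    fun s hs t ht => ?_
  have hint : ∀ r ∈ uIcc a b, IntervalIntegrable f volume a r := fun r hr =>
    hf.mono_set (uIcc_subset_uIcc_left hr)
  have hM0 : 0 ≤ M := (norm_nonneg _).trans (hM s hs)
  set X : ℝ → E := fun t => ξ + ∫ τ in a..t, f τ
  have hsum : |‖X s‖ + ‖X t‖| ≤ 2 * M := by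
    rw [abs_of_nonneg (by positivity)]
    linarith [hM s hs, hM t ht]
  have hdiff : |‖X s‖ - ‖X t‖| ≤ |(∫ τ in a..s, ‖f τ‖) - ∫ τ in a..t, ‖f τ‖| := by
    refine (abs_norm_sub_norm_le _ _).trans ?_
    rw [add_sub_add_left_eq_sub, intervalIntegral.integral_interval_sub_left (hint s hs)
      (hint t ht), intervalIntegral.integral_interval_sub_left (hint s hs).norm (hint t ht).norm]
    exact intervalIntegral.norm_integral_le_abs_integral_norm
  calc dist (‖X s‖ ^ 2) (‖X t‖ ^ 2) = |‖X s‖ + ‖X t‖| * |‖X s‖ - ‖X t‖| := by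
        rw [Real.dist_eq, ← abs_mul, sq_sub_sq]
    _ ≤ 2 * M * |(∫ τ in a..s, ‖f τ‖) - ∫ τ in a..t, ‖f τ‖| := by gcongr
    _ = _ := by rw [Real.dist_eq, ← mul_sub, abs_mul, abs_of_nonneg (by positivity : 0 ≤ 2 * M)]

theorem norm_sq_add_integral_sub_norm_sq {H : Type*} [NormedAddCommGroup H]
    [InnerProductSpace ℝ H] [CompleteSpace H] {f : ℝ → H} {a b : ℝ}
    (hf : IntervalIntegrable f volume a b) (ξ : H) :
    ‖ξ + ∫ τ in a..b, f τ‖ ^ 2 - ‖ξ‖ ^ 2 =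
      ∫ t in a..b, 2 * inner ℝ (ξ + ∫ τ in a..t, f τ) (f t) := by
  have hFTC := (absolutelyContinuousOnInterval_norm_sq_integral hf ξ).integral_deriv_eq_sub
  simp only [intervalIntegral.integral_same, add_zero] at hFTC
  rw [← hFTC]
  refine intervalIntegral.integral_congr_ae ?_
  filter_upwards [hf.ae_hasDerivAt_integral] with t ht htab
  exact ((ht (uIoc_subset_uIcc htab) a left_mem_uIcc).const_add ξ).norm_sq.deriv

/-! ### Inputs -/

section Inputs

variable {α E X U : Type*} [NormedAddCommGroup E] [NormedAddCommGroup X] [NormedAddCommGroup U]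

theorem exists_ae_bound_of_memLp_top [MeasurableSpace α] {μ : Measure α} {u : α → E}
    (hu : MemLp u ∞ μ) : ∃ M, 0 ≤ M ∧ ∀ᵐ t ∂μ, ‖u t‖ ≤ M := by
  refine ⟨(eLpNormEssSup u μ).toReal, ENNReal.toReal_nonneg, ?_⟩
  have hfin : eLpNormEssSup u μ ≠ ∞ := by simpa [eLpNorm_exponent_top] using hu.2.ne
  filter_upwards [ae_le_eLpNormEssSup (f := u) (μ := μ)] with t ht
  simpa using ENNReal.toReal_mono hfin ht

theorem memLp_top_comp [MeasurableSpace α] {μ : Measure α} [ProperSpace X] {G : X → E}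
    (hG : Continuous G) {p : α → X} (hp : MemLp p ∞ μ) : MemLp (fun a => G (p a)) ∞ μ := by
  obtain ⟨M, -, hM⟩ := exists_ae_bound_of_memLp_top hp
  obtain ⟨D, hD⟩ := (isCompact_closedBall (0 : X) M).exists_bound_of_continuousOn hG.continuousOn
  refine memLp_top_of_bound (hG.comp_aestronglyMeasurable hp.1) D ?_
  filter_upwards [hM] with a ha
  exact hD _ (mem_closedBall_zero_iff.2 ha)

theorem memLp_top_prodMk [MeasurableSpace α] {μ : Measure α} {x : α → X} {u : α → U}
    (hx : MemLp x ∞ μ) (hu : MemLp u ∞ μ) : MemLp (fun a => (x a, u a)) ∞ μ := by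
  obtain ⟨M, -, hM⟩ := exists_ae_bound_of_memLp_top hx
  obtain ⟨N, -, hN⟩ := exists_ae_bound_of_memLp_top hu
  refine memLp_top_of_bound (hx.1.prodMk hu.1) (max M N) ?_
  filter_upwards [hM, hN] with a ha ha'
  exact max_le_max ha ha'

theorem memLp_top_of_continuousOn_Icc {a b : ℝ} {x : ℝ → X} (hx : ContinuousOn x (Icc a b)) :
    MemLp x ∞ (volume.restrict (Icc a b)) := by
  obtain ⟨C, hC⟩ := isCompact_Icc.exists_bound_of_continuousOn hx
  exact memLp_top_of_bound (hx.aestronglyMeasurable measurableSet_Icc) C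
    ((ae_restrict_mem measurableSet_Icc).mono hC)

theorem integrable_inner_of_memLp_two [MeasurableSpace α] {μ : Measure α} {H : Type*}
    [NormedAddCommGroup H] [InnerProductSpace ℝ H] {g h : α → H} (hg : MemLp g 2 μ)
    (hh : MemLp h 2 μ) : Integrable (fun a => inner ℝ (g a) (h a)) μ :=
  (hg.norm.integrable_mul hh.norm).mono (hg.1.inner hh.1)
    (Eventually.of_forall fun a => by
      simpa only [Pi.mul_apply, norm_mul, norm_norm] using norm_inner_le_norm (𝕜 := ℝ) _ _)

theorem AdmissibleInput.mono {m : ℕ} {a b c d : ℝ} {u : ℝ → Euc m} (hu : AdmissibleInput a b u)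
    (h : Icc c d ⊆ Icc a b) : AdmissibleInput c d u :=
  hu.mono_measure (Measure.restrict_mono h le_rfl)

end Inputs

/-! ### Carathéodory solutions -/

namespace IsSolution

variable {n m : ℕ} {f g : ℝ → Euc n → Euc n} {a b s t : ℝ} {ξ η : Euc n} {x y : ℝ → Euc n}

theorem intervalIntegrable (hx : IsSolution f a b ξ x) (hs : s ∈ Icc a b) (ht : t ∈ Icc a b) :
    IntervalIntegrable (fun τ => f τ (x τ)) volume s t :=
  intervalIntegrable_of_integrableOn_Icc
    (integrableOn_Icc_of_intervalIntegrable (hs.1.trans hs.2) hx.integrable) hs ht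

theorem eq_initial (hx : IsSolution f a b ξ x) (hab : a ≤ b) : x a = ξ := by
  simpa using hx.eq_integral a (left_mem_Icc.2 hab)

theorem eq_add_integral (hx : IsSolution f a b ξ x) (hs : s ∈ Icc a b) (ht : t ∈ Icc a b) :
    x t = x s + ∫ τ in s..t, f τ (x τ) := by
  have ha : a ∈ Icc a b := left_mem_Icc.2 (hs.1.trans hs.2)
  rw [hx.eq_integral t ht, hx.eq_integral s hs, add_assoc,
    intervalIntegral.integral_add_adjacent_intervals (hx.intervalIntegrable ha hs)
      (hx.intervalIntegrable hs ht)]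

theorem restrict (hx : IsSolution f a b ξ x) (hs : s ∈ Icc a b) : IsSolution f s b (x s) x where
  continuousOn := hx.continuousOn.mono (Icc_subset_Icc_left hs.1)
  integrable := hx.intervalIntegrable hs ⟨hs.1.trans hs.2, le_rfl⟩
  eq_integral _ ht := hx.eq_add_integral hs ⟨hs.1.trans ht.1, ht.2⟩

theorem congr (hx : IsSolution f a b ξ x) (hab : a ≤ b)
    (h : ∀ τ ∈ Ioc a b, f τ (x τ) = g τ (x τ)) : IsSolution g a b ξ x := by
  refine ⟨hx.continuousOn, hx.integrable.congr (by rwa [uIoc_of_le hab]), fun t ht => ?_⟩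
  rw [hx.eq_integral t ht]
  congr 1
  refine intervalIntegral.integral_congr_ae (Eventually.of_forall fun τ hτ => ?_)
  rw [uIoc_of_le ht.1] at hτ
  exact h τ ⟨hτ.1, hτ.2.trans ht.2⟩

theorem sub (hx : IsSolution f a b ξ x) (hy : IsSolution g a b η y) :
    IsSolution (fun τ _ => f τ (x τ) - g τ (y τ)) a b (ξ - η) (x - y) where
  continuousOn := hx.continuousOn.sub hy.continuousOn
  integrable := hx.integrable.sub hy.integrable
  eq_integral t ht := by
    have ha : a ∈ Icc a b := ⟨le_rfl, ht.1.trans ht.2⟩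
    rw [intervalIntegral.integral_sub (hx.intervalIntegrable ha ht) (hy.intervalIntegrable ha ht),
      Pi.sub_apply, hx.eq_integral t ht, hy.eq_integral t ht]
    abel

theorem const_smul (hx : IsSolution f a b ξ x) (c : ℝ) :
    IsSolution (fun τ _ => c • f τ (x τ)) a b (c • ξ) (c • x) where
  continuousOn := hx.continuousOn.const_smul c
  integrable := hx.integrable.smul c
  eq_integral t ht := by
    rw [intervalIntegral.integral_smul, ← smul_add, ← hx.eq_integral t ht, Pi.smul_apply]

theorem extend_zero (hx : IsSolution f s b 0 x) (hs : s ∈ Icc a b)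
    (hg : ∀ τ ∈ Ioc a s, g τ 0 = 0) (hfg : ∀ τ ∈ Ioc s b, f τ (x τ) = g τ (x τ)) :
    IsSolution g a b 0 (fun t => x (max s t)) := by
  have hxs : x s = 0 := hx.eq_initial hs.2
  have hx := hx.congr hs.2 hfg
  have hleft : ∀ t ≤ s, EqOn (fun τ => g τ (x (max s τ))) 0 (Ioc a t) := fun t ht τ hτ => by
    simp only [max_eq_left (hτ.2.trans ht), hxs, Pi.zero_apply]
    exact hg τ ⟨hτ.1, hτ.2.trans ht⟩
  have hright : ∀ t, EqOn (fun τ => g τ (x (max s τ))) (fun τ => g τ (x τ)) (Ioc s t) :=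
    fun t τ hτ => by simp only [max_eq_right hτ.1.le]
  have hint_left : IntervalIntegrable (fun τ => g τ (x (max s τ))) volume a s :=
    (intervalIntegrable_congr (by rw [uIoc_of_le hs.1]; exact hleft s le_rfl)).2
      (intervalIntegrable_const (c := 0))
  have hint_right : ∀ t ∈ Icc s b, IntervalIntegrable (fun τ => g τ (x (max s τ))) volume s t :=
    fun t ht => (intervalIntegrable_congr (by rw [uIoc_of_le ht.1]; exact hright t)).2
      (hx.intervalIntegrable ⟨le_rfl, hs.2⟩ ht)
  have hzero : ∀ t ∈ Icc a s, ∫ τ in a..t, g τ (x (max s τ)) = 0 := fun t ht => by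
    rw [intervalIntegral.integral_of_le ht.1, setIntegral_congr_fun measurableSet_Ioc
      (hleft t ht.2)]
    simp
  refine ⟨hx.continuousOn.comp (by fun_prop) fun t ht => ⟨le_max_left _ _, max_le hs.2 ht.2⟩,
    hint_left.trans (hint_right b ⟨hs.2, le_rfl⟩), fun t ht => ?_⟩
  rcases le_total t s with hts | hst
  · rw [hzero t ⟨ht.1, hts⟩, max_eq_left hts, hxs, add_zero]
  · rw [← intervalIntegral.integral_add_adjacent_intervals hint_left (hint_right t ⟨hst, ht.2⟩),
      hzero s ⟨hs.1, le_rfl⟩, intervalIntegral.integral_of_le hst,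
      setIntegral_congr_fun measurableSet_Ioc (hright t), max_eq_right hst,
      hx.eq_integral t ⟨hst, ht.2⟩, intervalIntegral.integral_of_le hst, zero_add, zero_add]

theorem norm_le (hx : IsSolution f a b 0 x) {L : ℝ} (hL : 0 ≤ L) {e : ℝ → ℝ}
    (he : IntegrableOn e (Icc a b)) (he0 : 0 ≤ᵐ[volume.restrict (Icc a b)] e)
    (hf : ∀ᵐ τ ∂volume.restrict (Icc a b), ‖f τ (x τ)‖ ≤ L * ‖x τ‖ + e τ) (ht : t ∈ Icc a b) :
    ‖x t‖ ≤ (∫ τ in a..b, e τ) * Real.exp (L * (t - a)) :=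
  norm_le_integral_mul_exp hL hx.continuousOn he he0
    (fun t ht => by rw [hx.eq_integral t ht, zero_add]) hf ht

theorem norm_sq_sub_norm_sq (hx : IsSolution f a b ξ x) (hs : s ∈ Icc a b) (ht : t ∈ Icc a b)
    (hst : s ≤ t) : ‖x t‖ ^ 2 - ‖x s‖ ^ 2 = ∫ τ in s..t, 2 * inner ℝ (x τ) (f τ (x τ)) := by
  have hrestrict : ∀ τ ∈ Icc s t, x τ = x s + ∫ r in s..τ, f r (x r) := fun τ hτ =>
    hx.eq_add_integral hs ⟨hs.1.trans hτ.1, hτ.2.trans ht.2⟩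
  rw [hrestrict t ⟨hst, le_rfl⟩, norm_sq_add_integral_sub_norm_sq (hx.intervalIntegrable hs ht)]
  refine intervalIntegral.integral_congr fun τ hτ => ?_
  rw [uIcc_of_le hst] at hτ
  simp only [← hrestrict τ hτ]

theorem abs_norm_sq_sub_le {v : ℝ → Euc m} (hx : IsSolution f a b ξ x)
    (hv : AdmissibleInput a b v) {L : ℝ} (hL : 0 ≤ L)
    (hf : ∀ τ ∈ Icc a b, ‖f τ (x τ)‖ ≤ L * (‖x τ‖ + ‖v τ‖))
    (hs : s ∈ Icc a b) (ht : t ∈ Icc a b) (hst : s ≤ t) :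
    |‖x t‖ ^ 2 - ‖x s‖ ^ 2| ≤ L * ∫ τ in s..t, (3 * ‖x τ‖ ^ 2 + ‖v τ‖ ^ 2) := by
  have hG : Continuous fun p : Euc n × Euc m => 3 * ‖p.1‖ ^ 2 + ‖p.2‖ ^ 2 := by fun_prop
  have hint := intervalIntegrable_of_memLp_top (memLp_top_comp hG
    (memLp_top_prodMk (memLp_top_of_continuousOn_Icc hx.continuousOn) hv)) hs ht
  rw [hx.norm_sq_sub_norm_sq hs ht hst, ← intervalIntegral.integral_const_mul, ← Real.norm_eq_abs]
  refine intervalIntegral.norm_integral_le_of_norm_le hst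
    (Eventually.of_forall fun τ hτ => ?_) (hint.const_mul L)
  have hinner := (norm_inner_le_norm (𝕜 := ℝ) (x τ) (f τ (x τ))).trans
    (mul_le_mul_of_nonneg_left (hf τ ⟨hs.1.trans hτ.1.le, hτ.2.trans ht.2⟩) (norm_nonneg (x τ)))
  rw [norm_mul, Real.norm_of_nonneg zero_le_two]
  linarith [mul_nonneg hL (sq_nonneg (‖x τ‖ - ‖v τ‖))]

end IsSolution

theorem integral_mul_exp_mul_sub (c a t : ℝ) :
    ∫ τ in a..t, c * Real.exp (c * (τ - a)) = Real.exp (c * (t - a)) - 1 := by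
  have hderiv : ∀ τ ∈ uIcc a t,
      HasDerivAt (fun τ => Real.exp (c * (τ - a))) (c * Real.exp (c * (τ - a))) τ := fun τ _ => by
    simpa [mul_comm] using (((hasDerivAt_id τ).sub_const a).const_mul c).exp
  rw [intervalIntegral.integral_eq_sub_of_hasDerivAt hderiv
    (Continuous.intervalIntegrable (by fun_prop) _ _)]
  simp

theorem norm_integral_sub_le_half_mul_exp {E : Type*} [NormedAddCommGroup E] [NormedSpace ℝ E]
    {f : ℝ → E → E} {a t L D : ℝ} (hat : a ≤ t) (hL : 0 ≤ L) (hD : 0 ≤ D)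
    (hf : ∀ τ y₁ y₂, ‖f τ y₁ - f τ y₂‖ ≤ L * ‖y₁ - y₂‖) {y₁ y₂ : ℝ → E}
    (hy : ∀ τ, ‖y₁ τ - y₂ τ‖ ≤ D * Real.exp (2 * L * (τ - a))) :
    ‖∫ τ in a..t, (f τ (y₁ τ) - f τ (y₂ τ))‖ ≤ D / 2 * Real.exp (2 * L * (t - a)) :=
  calc ‖∫ τ in a..t, (f τ (y₁ τ) - f τ (y₂ τ))‖
      ≤ ∫ τ in a..t, D / 2 * (2 * L * Real.exp (2 * L * (τ - a))) := by
        refine intervalIntegral.norm_integral_le_of_norm_le hat (Eventually.of_forall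
          fun τ _ => ?_) (Continuous.intervalIntegrable (by fun_prop) _ _)
        exact ((hf τ _ _).trans (mul_le_mul_of_nonneg_left (hy τ) hL)).trans_eq (by ring)
    _ = D / 2 * (Real.exp (2 * L * (t - a)) - 1) := by
        rw [intervalIntegral.integral_const_mul, integral_mul_exp_mul_sub]
    _ ≤ D / 2 * Real.exp (2 * L * (t - a)) := by gcongr; linarith

/-- The Picard operator of `ẏ = f(t, y)`, `y(a) = ξ`, in the unknown `exp (-c (t - a)) • y(t)`.
For `c` twice the Lipschitz constant it is a contraction, however long the interval is. -/
noncomputable def weightedPicard {n : ℕ} (f : ℝ → Euc n → Euc n) (a c : ℝ) (ξ : Euc n)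
    (y : ℝ → Euc n) (t : ℝ) : Euc n :=
  Real.exp (-(c * (t - a))) • (ξ + ∫ τ in a..t, f τ (Real.exp (c * (τ - a)) • y τ))

theorem continuousOn_weightedPicard {n : ℕ} {f : ℝ → Euc n → Euc n} {a b c : ℝ} (hab : a ≤ b)
    {y : ℝ → Euc n} (ξ : Euc n)
    (hy : IntervalIntegrable (fun τ => f τ (Real.exp (c * (τ - a)) • y τ)) volume a b) :
    ContinuousOn (weightedPicard f a c ξ y) (Icc a b) := by
  have hprim := intervalIntegral.continuousOn_primitive_interval' hy left_mem_uIcc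
  rw [uIcc_of_le hab] at hprim
  exact (by fun_prop : Continuous fun t => Real.exp (-(c * (t - a)))).continuousOn.smul
    (continuousOn_const.add hprim)

theorem norm_weightedPicard_sub_le {n : ℕ} {f : ℝ → Euc n → Euc n} {a t L D : ℝ} (hat : a ≤ t)
    (hL : 0 ≤ L) (hD : 0 ≤ D) (hf : ∀ τ y₁ y₂, ‖f τ y₁ - f τ y₂‖ ≤ L * ‖y₁ - y₂‖)
    {y₁ y₂ : ℝ → Euc n} (ξ : Euc n)
    (hy₁ : IntervalIntegrable (fun τ => f τ (Real.exp (2 * L * (τ - a)) • y₁ τ)) volume a t)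
    (hy₂ : IntervalIntegrable (fun τ => f τ (Real.exp (2 * L * (τ - a)) • y₂ τ)) volume a t)
    (hy : ∀ τ, ‖y₁ τ - y₂ τ‖ ≤ D) :
    ‖weightedPicard f a (2 * L) ξ y₁ t - weightedPicard f a (2 * L) ξ y₂ t‖ ≤ D / 2 := by
  have hbound := norm_integral_sub_le_half_mul_exp
    (y₁ := fun τ => Real.exp (2 * L * (τ - a)) • y₁ τ)
    (y₂ := fun τ => Real.exp (2 * L * (τ - a)) • y₂ τ) hat hL hD hf fun τ => by
      rw [← smul_sub, norm_smul, Real.norm_of_nonneg (Real.exp_nonneg _), mul_comm]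
      gcongr
      exact hy τ
  rw [weightedPicard, weightedPicard, ← smul_sub, add_sub_add_left_eq_sub,
    ← intervalIntegral.integral_sub hy₁ hy₂, norm_smul, Real.norm_of_nonneg (Real.exp_nonneg _),
    Real.exp_neg, inv_mul_le_iff₀ (Real.exp_pos _), mul_comm (Real.exp _)]
  exact hbound

theorem exists_isSolution {n : ℕ} {f : ℝ → Euc n → Euc n} {a b L : ℝ} (hab : a ≤ b)
    (hL : 0 ≤ L) (hf : ∀ τ y₁ y₂, ‖f τ y₁ - f τ y₂‖ ≤ L * ‖y₁ - y₂‖)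
    (hint : ∀ y : ℝ → Euc n, ContinuousOn y (Icc a b) →
      IntervalIntegrable (fun τ => f τ (y τ)) volume a b) (ξ : Euc n) :
    ∃ x, IsSolution f a b ξ x := by
  let w : C(Icc a b, Euc n) → ℝ → Euc n := fun y τ =>
    Real.exp (2 * L * (τ - a)) • IccExtend hab y τ
  have hw : ∀ y, Continuous (w y) := fun y =>
    (by fun_prop : Continuous fun τ => Real.exp (2 * L * (τ - a))).smul
      (y.continuous.Icc_extend' (h := hab))
  have hwi : ∀ y, IntervalIntegrable (fun τ => f τ (w y τ)) volume a b := fun y =>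
    hint _ (hw y).continuousOn
  have hwi' : ∀ y, ∀ t ∈ Icc a b, IntervalIntegrable (fun τ => f τ (w y τ)) volume a t :=
    fun y t ht => (hwi y).mono_set (uIcc_subset_uIcc_left (by rwa [uIcc_of_le hab]))
  let Φ : C(Icc a b, Euc n) → C(Icc a b, Euc n) := fun y =>
    ⟨fun t => weightedPicard f a (2 * L) ξ (IccExtend hab y) t,
      continuousOn_iff_continuous_domRestrict.1 (continuousOn_weightedPicard hab ξ (hwi y))⟩
  have hΦ : ContractingWith (1 / 2) Φ := by
    refine ⟨by rw [← NNReal.coe_lt_coe]; norm_num, LipschitzWith.of_dist_le_mul fun y₁ y₂ => ?_⟩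
    refine (ContinuousMap.dist_le (by positivity)).2 fun t => ?_
    rw [dist_eq_norm]
    refine (norm_weightedPicard_sub_le t.2.1 hL dist_nonneg hf ξ (hwi' y₁ t t.2) (hwi' y₂ t t.2)
      fun τ => ?_).trans_eq (by push_cast; ring)
    rw [← dist_eq_norm]
    exact ContinuousMap.dist_apply_le_dist _
  have : Nonempty C(Icc a b, Euc n) := ⟨0⟩
  obtain ⟨y, hy⟩ : ∃ y, Φ y = y := ⟨hΦ.fixedPoint Φ, hΦ.fixedPoint_isFixedPt⟩
  refine ⟨w y, (hw y).continuousOn, hwi y, fun t ht => ?_⟩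
  calc w y t = Real.exp (2 * L * (t - a)) • Φ y ⟨t, ht⟩ := by
        rw [hy]; simp only [w, IccExtend_of_mem hab _ ht]
    _ = _ := by
        simp only [Φ, ContinuousMap.coe_mk, weightedPicard, smul_smul, ← Real.exp_add,
          add_neg_cancel, Real.exp_zero, one_smul, w]

/-! ### The pseudoinverse and its measurable dependence on the data -/

section Pinv

variable {n m : ℕ}

theorem pinv_mem_ker_orthogonal (B : Euc m →L[ℝ] Euc n) (d : Euc n) :
    pinv B d ∈ (LinearMap.ker B.toLinearMap)ᗮ :=
  Subtype.property _

theorem apply_pinv (B : Euc m →L[ℝ] Euc n) (d : Euc n) :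
    B (pinv B d) = (LinearMap.range B.toLinearMap).orthogonalProjectionOnto d :=
  congrArg Subtype.val
    ((LinearEquiv.ofBijective (coreMap B) (coreMap_bijective B)).apply_symm_apply _)

theorem apply_pinv_of_mem_range (B : Euc m →L[ℝ] Euc n) {d : Euc n} (hd : d ∈ range B) :
    B (pinv B d) = d := by
  rw [apply_pinv]
  exact Submodule.starProjection_eq_self_iff.2 hd

theorem adjoint_apply_pinv (B : Euc m →L[ℝ] Euc n) (d : Euc n) :
    B.adjoint (B (pinv B d)) = B.adjoint d := by
  have horth : d - B (pinv B d) ∈ (LinearMap.range B.toLinearMap)ᗮ := by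
    rw [apply_pinv]
    exact Submodule.sub_starProjection_mem_orthogonal d
  rw [show (LinearMap.range B.toLinearMap)ᗮ = B.adjoint.ker from B.orthogonal_range] at horth
  have hzero : B.adjoint (d - B (pinv B d)) = 0 := horth
  rw [map_sub, sub_eq_zero] at hzero
  exact hzero.symm

theorem exists_adjoint_apply_apply_eq_pinv (B : Euc m →L[ℝ] Euc n) (d : Euc n) :
    ∃ r, B.adjoint (B r) = pinv B d := by
  have hmem := pinv_mem_ker_orthogonal B d
  rwa [LinearMap.orthogonal_ker, ← LinearMap.range_adjoint_comp_self] at hmem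

end Pinv

section Tikhonov

variable {G H : Type*} [NormedAddCommGroup G] [InnerProductSpace ℝ G] [CompleteSpace G]
  [NormedAddCommGroup H] [InnerProductSpace ℝ H] [CompleteSpace H]

/-- The Tikhonov operator `B* B + c`, whose inverse applied to `B* d` approximates `B† d`
as `c → 0`. -/
noncomputable def tikhonov (c : ℝ) (B : G →L[ℝ] H) : G →L[ℝ] G :=
  B.adjoint ∘L B + c • (1 : G →L[ℝ] G)

theorem tikhonov_apply (c : ℝ) (B : G →L[ℝ] H) (v : G) :
    tikhonov c B v = B.adjoint (B v) + c • v := rfl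

theorem mul_norm_le_norm_tikhonov_apply (c : ℝ) (B : G →L[ℝ] H) (v : G) :
    c * ‖v‖ ≤ ‖tikhonov c B v‖ := by
  rcases eq_or_ne v 0 with rfl | hv
  · simp
  refine le_of_mul_le_mul_right ?_ (norm_pos_iff.2 hv)
  calc c * ‖v‖ * ‖v‖ ≤ ‖B v‖ ^ 2 + c * ‖v‖ ^ 2 := by linarith [sq_nonneg ‖B v‖]
    _ = inner ℝ (tikhonov c B v) v := by
        rw [tikhonov_apply, inner_add_left, ContinuousLinearMap.adjoint_inner_left,
          real_inner_self_eq_norm_sq, real_inner_smul_left, real_inner_self_eq_norm_sq]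
    _ ≤ ‖tikhonov c B v‖ * ‖v‖ := real_inner_le_norm _ _

theorem isUnit_tikhonov [FiniteDimensional ℝ G] {c : ℝ} (hc : 0 < c) (B : G →L[ℝ] H) :
    IsUnit (tikhonov c B) := by
  rw [ContinuousLinearMap.isUnit_iff_isUnit_toLinearMap, LinearMap.isUnit_iff_ker_eq_bot,
    LinearMap.ker_eq_bot']
  intro v (hv : tikhonov c B v = 0)
  have hle := mul_norm_le_norm_tikhonov_apply c B v
  rw [hv, norm_zero] at hle
  exact norm_le_zero_iff.1 (nonpos_of_mul_nonpos_right hle hc)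

theorem continuous_ringInverse_tikhonov_apply [FiniteDimensional ℝ G] {X : Type*}
    [TopologicalSpace X] {c : ℝ} (hc : 0 < c) {B : X → G →L[ℝ] H} {d : X → H}
    (hB : Continuous B) (hd : Continuous d) :
    Continuous fun p => Ring.inverse (tikhonov c (B p)) ((B p).adjoint (d p)) := by
  have hadj : Continuous fun p => (B p).adjoint :=
    (ContinuousLinearMap.adjoint (𝕜 := ℝ) (E := G) (F := H)).continuous.comp hB
  have htik : Continuous fun p => tikhonov c (B p) := (hadj.clm_comp hB).add continuous_const
  refine Continuous.clm_apply (continuous_iff_continuousAt.2 fun p => ?_) (hadj.clm_apply hd)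
  have hinv := NormedRing.inverse_continuousAt (isUnit_tikhonov hc (B p)).unit
  rw [IsUnit.unit_spec] at hinv
  exact ContinuousAt.comp (f := fun p => tikhonov c (B p)) hinv htik.continuousAt

end Tikhonov

section MeasurablePinv

variable {n m : ℕ}

theorem norm_ringInverse_tikhonov_sub_pinv_le {c : ℝ} (hc : 0 < c) {B : Euc m →L[ℝ] Euc n}
    {d : Euc n} {r : Euc m} (hr : B.adjoint (B r) = pinv B d) :
    ‖Ring.inverse (tikhonov c B) (B.adjoint d) - pinv B d‖ ≤ c * (2 * ‖r‖) := by
  set w := Ring.inverse (tikhonov c B) (B.adjoint d)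
  have hw : tikhonov c B w = B.adjoint d :=
    DFunLike.congr_fun (Ring.mul_inverse_cancel _ (isUnit_tikhonov hc B)) _
  have herr : tikhonov c B (w - pinv B d + c • r) = (c * c) • r := by
    rw [map_add, map_sub, hw, map_smul, tikhonov_apply, tikhonov_apply, hr, adjoint_apply_pinv,
      smul_add, smul_smul]
    abel
  have hle := mul_norm_le_norm_tikhonov_apply c B (w - pinv B d + c • r)
  rw [herr, norm_smul, Real.norm_of_nonneg (mul_nonneg hc.le hc.le), mul_assoc] at hle
  calc ‖w - pinv B d‖ = ‖(w - pinv B d + c • r) - c • r‖ := by rw [add_sub_cancel_right]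
    _ ≤ ‖w - pinv B d + c • r‖ + ‖c • r‖ := norm_sub_le _ _
    _ ≤ c * ‖r‖ + c * ‖r‖ := by
        rw [norm_smul, Real.norm_of_nonneg hc.le]
        gcongr
        exact le_of_mul_le_mul_left hle hc
    _ = c * (2 * ‖r‖) := by ring

theorem tendsto_ringInverse_tikhonov_pinv (B : Euc m →L[ℝ] Euc n) (d : Euc n) :
    Tendsto (fun k : ℕ => Ring.inverse (tikhonov (1 / ((k : ℝ) + 1)) B) (B.adjoint d))
      atTop (𝓝 (pinv B d)) := by
  obtain ⟨r, hr⟩ := exists_adjoint_apply_apply_eq_pinv B d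
  rw [tendsto_iff_norm_sub_tendsto_zero]
  refine squeeze_zero (fun _ => norm_nonneg _)
    (fun k => norm_ringInverse_tikhonov_sub_pinv_le Nat.one_div_pos_of_nat hr) ?_
  simpa using tendsto_one_div_add_atTop_nhds_zero_nat.mul_const (2 * ‖r‖)

theorem measurable_pinv {X : Type*} [TopologicalSpace X] [MeasurableSpace X] [BorelSpace X]
    {B : X → Euc m →L[ℝ] Euc n} {d : X → Euc n} (hB : Continuous B) (hd : Continuous d) :
    Measurable fun p => pinv (B p) (d p) :=
  measurable_of_tendsto_metrizable
    (fun _ => (continuous_ringInverse_tikhonov_apply Nat.one_div_pos_of_nat hB hd).measurable)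
    (tendsto_pi_nhds.2 fun p => tendsto_ringInverse_tikhonov_pinv (B p) (d p))

end MeasurablePinv

/-! ### Expansions to first order, uniformly along a filter -/

theorem exists_pos_norm_sub_sub_fderiv_le {P E : Type*} [NormedAddCommGroup P] [NormedSpace ℝ P]
    [ProperSpace P] [NormedAddCommGroup E] [NormedSpace ℝ E] {G : P → E} (hG : ContDiff ℝ 1 G)
    (M : ℝ) {δ : ℝ} (hδ : 0 < δ) :
    ∃ ρ > 0, ∀ x y, ‖x‖ ≤ M → ‖y - x‖ ≤ ρ → ‖G y - G x - fderiv ℝ G x (y - x)‖ ≤ δ * ‖y - x‖ := by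
  obtain ⟨ρ, hρ, hunif⟩ := Metric.uniformContinuousOn_iff_le.1
    ((isCompact_closedBall (0 : P) (M + 1)).uniformContinuousOn_of_continuous
      (hG.continuous_fderiv one_ne_zero).continuousOn) δ hδ
  refine ⟨min ρ 1, lt_min hρ one_pos, fun x y hx hy => ?_⟩
  refine (convex_closedBall x ‖y - x‖).norm_image_sub_le_of_norm_fderiv_le'
    (fun w _ => hG.differentiable one_ne_zero w) (fun w hw => ?_)
    (Metric.mem_closedBall_self (norm_nonneg _)) (mem_closedBall_iff_norm.2 le_rfl)
  have hwx : dist w x ≤ min ρ 1 := (Metric.mem_closedBall.1 hw).trans hy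
  have hw1 : ‖w - x‖ ≤ 1 := (dist_eq_norm w x).symm.trans_le (hwx.trans (min_le_right _ _))
  rw [← dist_eq_norm]
  refine hunif w (mem_closedBall_zero_iff.2 ?_) x (mem_closedBall_zero_iff.2 (by linarith))
    (hwx.trans (min_le_left _ _))
  linarith [norm_le_norm_add_norm_sub' w x]

/-- The family `p` has the first order expansion `p η = p₀ + η p' + o(η)` as `η → 0`, uniformly
along the filter `l`. For `l = ae μ` this is differentiability in `L^∞(μ)`, for `l = pure t`
differentiability at the point `t`. -/
def HasUniformDeriv {α P : Type*} [NormedAddCommGroup P] [NormedSpace ℝ P] (l : Filter α)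
    (p : ℝ → α → P) (p₀ p' : α → P) : Prop :=
  ∀ δ > 0, ∀ᶠ η in 𝓝 (0 : ℝ), ∀ᶠ a in l, ‖p η a - p₀ a - η • p' a‖ ≤ δ * |η|

namespace HasUniformDeriv

variable {α P U E : Type*} [NormedAddCommGroup P] [NormedSpace ℝ P] [NormedAddCommGroup U]
  [NormedSpace ℝ U] [NormedAddCommGroup E] [NormedSpace ℝ E] {l l' : Filter α} {p : ℝ → α → P}
  {p₀ p' : α → P} {q : ℝ → α → U} {q₀ q' : α → U} {M N C δ : ℝ}

theorem mono (h : HasUniformDeriv l p p₀ p') (hl : l' ≤ l) : HasUniformDeriv l' p p₀ p' :=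
  fun δ hδ => (h δ hδ).mono fun _ hη => hη.filter_mono hl

theorem eventually_eq (h : HasUniformDeriv l p p₀ p') : ∀ᶠ a in l, p 0 a = p₀ a :=
  (h 1 one_pos).self_of_nhds.mono fun a ha => by simpa [sub_eq_zero] using ha

theorem hasDerivAt {a : α} (h : HasUniformDeriv (pure a) p p₀ p') :
    HasDerivAt (fun η => p η a) (p' a) 0 := by
  have hzero : p 0 a = p₀ a := eventually_pure.1 h.eventually_eq
  refine hasDerivAt_iff_isLittleO_nhds_zero.2 (Asymptotics.isLittleO_iff.2 fun δ hδ => ?_)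
  filter_upwards [h δ hδ] with η hη
  rw [zero_add, hzero]
  exact hη

theorem eventually_norm_sub_le (h : HasUniformDeriv l p p₀ p') (hN : ∀ᶠ a in l, ‖p' a‖ ≤ N) :
    ∀ᶠ η in 𝓝 (0 : ℝ), ∀ᶠ a in l, ‖p η a - p₀ a‖ ≤ (1 + N) * |η| := by
  filter_upwards [h 1 one_pos] with η hη
  filter_upwards [hη, hN] with a ha hNa
  calc ‖p η a - p₀ a‖ ≤ ‖p η a - p₀ a - η • p' a‖ + ‖η • p' a‖ := norm_le_norm_sub_add _ _
    _ ≤ 1 * |η| + |η| * N := by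
        rw [norm_smul, Real.norm_eq_abs]
        gcongr
    _ = (1 + N) * |η| := by ring

theorem prodMk (hp : HasUniformDeriv l p p₀ p') (hq : HasUniformDeriv l q q₀ q') :
    HasUniformDeriv l (fun η a => (p η a, q η a)) (fun a => (p₀ a, q₀ a))
      fun a => (p' a, q' a) := by
  intro δ hδ
  filter_upwards [hp δ hδ, hq δ hδ] with η hpη hqη
  filter_upwards [hpη, hqη] with a hpa hqa
  exact max_le hpa hqa

theorem add_smul (u h : α → U) : HasUniformDeriv l (fun η => u + η • h) u h :=
  fun δ hδ => Eventually.of_forall fun η => Eventually.of_forall fun a => by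
    simpa using mul_nonneg hδ.le (abs_nonneg η)

theorem eventually_norm_sub_sub_fderiv_le [ProperSpace P] {G : P → E} (hG : ContDiff ℝ 1 G)
    (hM : ∀ᶠ a in l, ‖p₀ a‖ ≤ M)
    (hC : ∀ᶠ η in 𝓝 (0 : ℝ), ∀ᶠ a in l, ‖p η a - p₀ a‖ ≤ C * |η|) (hδ : 0 < δ) :
    ∀ᶠ η in 𝓝 (0 : ℝ), ∀ᶠ a in l,
      ‖G (p η a) - G (p₀ a) - fderiv ℝ G (p₀ a) (p η a - p₀ a)‖ ≤ δ * |η| := by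
  have hC1 : 0 < |C| + 1 := by positivity
  obtain ⟨ρ, hρ, hlin⟩ := exists_pos_norm_sub_sub_fderiv_le hG M (div_pos hδ hC1)
  have hsmall : ∀ᶠ η in 𝓝 (0 : ℝ), (|C| + 1) * |η| < ρ :=
    (by fun_prop : Continuous fun η : ℝ => (|C| + 1) * |η|).continuousAt.eventually_lt_const
      (by simpa)
  filter_upwards [hC, hsmall] with η hCη hη
  filter_upwards [hM, hCη] with a hMa hCa
  have hpa : ‖p η a - p₀ a‖ ≤ (|C| + 1) * |η| :=
    hCa.trans (by gcongr; linarith [le_abs_self C])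
  calc _ ≤ δ / (|C| + 1) * ‖p η a - p₀ a‖ := hlin _ _ hMa (hpa.trans hη.le)
    _ ≤ δ / (|C| + 1) * ((|C| + 1) * |η|) := by gcongr
    _ = δ * |η| := by field_simp

theorem comp [ProperSpace P] {G : P → E} (hG : ContDiff ℝ 1 G) (h : HasUniformDeriv l p p₀ p')
    (hM : ∀ᶠ a in l, ‖p₀ a‖ ≤ M) (hN : ∀ᶠ a in l, ‖p' a‖ ≤ N) :
    HasUniformDeriv l (fun η a => G (p η a)) (fun a => G (p₀ a))
      fun a => fderiv ℝ G (p₀ a) (p' a) := by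
  intro δ hδ
  obtain ⟨K, hK⟩ := (isCompact_closedBall (0 : P) M).exists_bound_of_continuousOn
    (hG.continuous_fderiv one_ne_zero).continuousOn
  filter_upwards [h (δ / 2 / (|K| + 1)) (by positivity),
    eventually_norm_sub_sub_fderiv_le hG hM (h.eventually_norm_sub_le hN) (half_pos hδ)]
    with η hpη hGη
  filter_upwards [hpη, hGη, hM] with a hpa hGa hMa
  have hKa : ‖fderiv ℝ G (p₀ a)‖ ≤ |K| + 1 := by
    linarith [hK _ (mem_closedBall_zero_iff.2 hMa), le_abs_self K]
  have hsplit : G (p η a) - G (p₀ a) - η • fderiv ℝ G (p₀ a) (p' a) =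
      (G (p η a) - G (p₀ a) - fderiv ℝ G (p₀ a) (p η a - p₀ a)) +
        fderiv ℝ G (p₀ a) (p η a - p₀ a - η • p' a) := by
    rw [map_sub _ (p η a - p₀ a), map_smul]
    abel
  calc _ ≤ δ / 2 * |η| + (|K| + 1) * (δ / 2 / (|K| + 1) * |η|) := by
        rw [hsplit]
        exact (norm_add_le _ _).trans (add_le_add hGa
          (((fderiv ℝ G (p₀ a)).le_of_opNorm_le hKa _).trans (by gcongr)))
    _ = δ * |η| := by field_simp; ring

theorem hasDerivAt_integral [MeasurableSpace α] {μ : Measure α} [IsFiniteMeasure μ]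
    {f : ℝ → α → E} {f₀ f' : α → E} (h : HasUniformDeriv (ae μ) f f₀ f')
    (hf : ∀ η, Integrable (f η) μ) (hf' : Integrable f' μ) :
    HasDerivAt (fun η => ∫ a, f η a ∂μ) (∫ a, f' a ∂μ) 0 := by
  refine hasDerivAt_iff_isLittleO_nhds_zero.2 (Asymptotics.isLittleO_iff.2 fun δ hδ => ?_)
  filter_upwards [h (δ / (μ.real univ + 1)) (by positivity)] with η hη
  have hint : (∫ a, f η a ∂μ) - (∫ a, f 0 a ∂μ) - η • ∫ a, f' a ∂μ =
      ∫ a, (f η a - f 0 a - η • f' a) ∂μ := by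
    rw [← integral_smul, ← integral_sub (hf η) (hf 0)]
    exact (integral_sub ((hf η).sub (hf 0)) (hf'.smul η)).symm
  rw [zero_add, hint]
  calc _ ≤ δ / (μ.real univ + 1) * |η| * μ.real univ := by
        refine norm_integral_le_of_norm_le_const ?_
        filter_upwards [hη, h.eventually_eq] with a ha ha0
        rw [ha0]
        exact ha
    _ ≤ δ / (μ.real univ + 1) * |η| * (μ.real univ + 1) := by gcongr; linarith
    _ = δ * ‖η‖ := by rw [Real.norm_eq_abs]; field_simp

end HasUniformDeriv

/-! ### Jacobians and trajectories of a Lipschitz system -/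

/-- The Lipschitz condition on `F` for the sum norm of the state and the input; Mathlib's
`LipschitzWith` on a product refers to the maximum of the two norms. -/
def JointlyLipschitz {X U Y : Type*} [NormedAddCommGroup X] [NormedAddCommGroup U]
    [NormedAddCommGroup Y] (L : ℝ) (F : X × U → Y) : Prop :=
  ∀ x₁ x₂ u₁ u₂, ‖F (x₁, u₁) - F (x₂, u₂)‖ ≤ L * (‖x₁ - x₂‖ + ‖u₁ - u₂‖)

section Jacobian

variable {n m : ℕ} {F : Euc n × Euc m → Euc n} {LF : ℝ}

theorem jacA_eq (hF : ContDiff ℝ 1 F) (x : Euc n) (u : Euc m) :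
    jacA F x u = (fderiv ℝ F (x, u)).comp (ContinuousLinearMap.inl ℝ (Euc n) (Euc m)) :=
  ((hF.differentiable one_ne_zero (x, u)).hasFDerivAt.comp x (hasFDerivAt_prodMk_left x u)).fderiv

theorem jacB_eq (hF : ContDiff ℝ 1 F) (x : Euc n) (u : Euc m) :
    jacB F x u = (fderiv ℝ F (x, u)).comp (ContinuousLinearMap.inr ℝ (Euc n) (Euc m)) :=
  ((hF.differentiable one_ne_zero (x, u)).hasFDerivAt.comp u (hasFDerivAt_prodMk_right x u)).fderiv

theorem fderiv_apply_eq_jacA_add_jacB (hF : ContDiff ℝ 1 F) (x v : Euc n) (u w : Euc m) :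
    fderiv ℝ F (x, u) (v, w) = jacA F x u v + jacB F x u w := by
  rw [jacA_eq hF, jacB_eq hF]
  simp [← map_add]

theorem continuous_jacA (hF : ContDiff ℝ 1 F) :
    Continuous fun p : Euc n × Euc m => jacA F p.1 p.2 := by
  simp_rw [jacA_eq hF]
  exact (hF.continuous_fderiv one_ne_zero).clm_comp continuous_const

theorem continuous_jacB (hF : ContDiff ℝ 1 F) :
    Continuous fun p : Euc n × Euc m => jacB F p.1 p.2 := by
  simp_rw [jacB_eq hF]
  exact (hF.continuous_fderiv one_ne_zero).clm_comp continuous_const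

theorem continuous_drift (hF : ContDiff ℝ 1 F) :
    Continuous fun p : Euc n × Euc m => drift F p.1 p.2 :=
  (hF.continuous.sub ((continuous_jacA hF).clm_apply continuous_fst)).sub
    ((continuous_jacB hF).clm_apply continuous_snd)

theorem JointlyLipschitz.norm_jacA_apply_le (h : JointlyLipschitz LF F) (hLF : 0 ≤ LF)
    (x v : Euc n) (u : Euc m) : ‖jacA F x u v‖ ≤ LF * ‖v‖ :=
  (jacA F x u).le_of_opNorm_le (norm_fderiv_le_of_lip' ℝ hLF
    (Eventually.of_forall fun y => by simpa using h y x u u)) v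

theorem JointlyLipschitz.norm_jacB_apply_le (h : JointlyLipschitz LF F) (hLF : 0 ≤ LF)
    (x : Euc n) (u v : Euc m) : ‖jacB F x u v‖ ≤ LF * ‖v‖ :=
  (jacB F x u).le_of_opNorm_le (norm_fderiv_le_of_lip' ℝ hLF
    (Eventually.of_forall fun v => by simpa using h x x v u)) v

end Jacobian

section Trajectory

variable {n m : ℕ} {F : Euc n × Euc m → Euc n} {LF T : ℝ} {x₀ : Euc n} {u v h : ℝ → Euc m}
  {x y z : ℝ → Euc n}

theorem exists_isTrajectory (hF : JointlyLipschitz LF F) (hLF : 0 ≤ LF) (hFc : Continuous F)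
    (hT : 0 ≤ T) (hu : AdmissibleInput 0 T u) (x₀ : Euc n) : ∃ x, IsTrajectory F T x₀ u x :=
  exists_isSolution hT hLF (fun τ y₁ y₂ => by simpa using hF y₁ y₂ (u τ) (u τ))
    (fun _ hy => intervalIntegrable_of_memLp_top
      (memLp_top_comp hFc (memLp_top_prodMk (memLp_top_of_continuousOn_Icc hy) hu))
      (left_mem_Icc.2 hT) (right_mem_Icc.2 hT)) x₀

theorem isTrajectory_stateTraj (hF : JointlyLipschitz LF F) (hLF : 0 ≤ LF) (hFc : Continuous F)
    (hT : 0 ≤ T) (hu : AdmissibleInput 0 T u) (x₀ : Euc n) :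
    IsTrajectory F T x₀ u (stateTraj F T x₀ u) := by
  have hex := exists_isTrajectory hF hLF hFc hT hu x₀
  rw [stateTraj, dif_pos hex]
  exact hex.choose_spec

theorem IsTrajectory.norm_sub_le (hx : IsTrajectory F T x₀ u x) (hF : JointlyLipschitz LF F)
    (hLF : 0 ≤ LF) (hu : AdmissibleInput 0 T u) (hv : AdmissibleInput 0 T v)
    (hy : IsTrajectory F T x₀ v y) {t : ℝ} (ht : t ∈ Icc 0 T) :
    ‖y t - x t‖ ≤ (LF * ∫ τ in (0 : ℝ)..T, ‖v τ - u τ‖) * Real.exp (LF * T) := by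
  have hT : 0 ≤ T := ht.1.trans ht.2
  have hint : IntegrableOn (fun τ => LF * ‖v τ - u τ‖) (Icc 0 T) :=
    ((hv.sub hu).integrable le_top).norm.const_mul LF
  have hsub := IsSolution.sub hy hx
  rw [sub_self] at hsub
  have hle := hsub.norm_le hLF hint (Eventually.of_forall fun _ => by positivity)
    (Eventually.of_forall fun τ => (hF _ _ _ _).trans_eq (mul_add _ _ _)) ht
  rw [intervalIntegral.integral_const_mul, sub_zero] at hle
  refine hle.trans ?_
  have hnn : 0 ≤ ∫ τ in (0 : ℝ)..T, ‖v τ - u τ‖ :=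
    intervalIntegral.integral_nonneg hT fun _ _ => norm_nonneg _
  gcongr
  exact ht.2

theorem AdmissibleInput.add_smul (hu : AdmissibleInput 0 T u) (hh : AdmissibleInput 0 T h)
    (η : ℝ) : AdmissibleInput 0 T (u + η • h) :=
  MemLp.add hu (MemLp.const_smul hh η)

theorem IsTrajectory.norm_stateTraj_add_smul_sub_le (hx : IsTrajectory F T x₀ u x)
    (hF : JointlyLipschitz LF F) (hLF : 0 ≤ LF) (hFc : Continuous F) (hu : AdmissibleInput 0 T u)
    (hh : AdmissibleInput 0 T h) (η : ℝ) {t : ℝ} (ht : t ∈ Icc 0 T) :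
    ‖stateTraj F T x₀ (u + η • h) t - x t‖ ≤
      (LF * ∫ τ in (0 : ℝ)..T, ‖h τ‖) * Real.exp (LF * T) * |η| := by
  have huη := hu.add_smul hh η
  refine (hx.norm_sub_le hF hLF hu huη
    (isTrajectory_stateTraj hF hLF hFc (ht.1.trans ht.2) huη x₀) ht).trans_eq ?_
  simp only [Pi.add_apply, Pi.smul_apply, add_sub_cancel_left, norm_smul,
    intervalIntegral.integral_const_mul, Real.norm_eq_abs]
  ring

theorem IsTrajectory.norm_sub_sub_smul_le (hx : IsTrajectory F T x₀ u x) (hFd : ContDiff ℝ 1 F)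
    (hF : JointlyLipschitz LF F) (hLF : 0 ≤ LF)
    (hz : IsSolution (fun τ y => jacA F (x τ) (u τ) y + jacB F (x τ) (u τ) (h τ)) 0 T 0 z)
    {η δ : ℝ} (hδ : 0 ≤ δ) (hy : IsTrajectory F T x₀ (u + η • h) y)
    (herr : ∀ᵐ τ ∂volume.restrict (Icc 0 T),
      ‖F (y τ, (u + η • h) τ) - F (x τ, u τ) -
        fderiv ℝ F (x τ, u τ) ((y τ, (u + η • h) τ) - (x τ, u τ))‖ ≤ δ)
    {t : ℝ} (ht : t ∈ Icc 0 T) :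
    ‖y t - x t - η • z t‖ ≤ T * δ * Real.exp (LF * T) := by
  have hT : 0 ≤ T := ht.1.trans ht.2
  have hsol := (IsSolution.sub hy hx).sub (hz.const_smul η)
  rw [sub_self, smul_zero, sub_zero] at hsol
  have hle := hsol.norm_le hLF (integrableOn_const (C := δ) (by simp))
    (Eventually.of_forall fun _ => hδ) (herr.mono fun τ hτ => ?_) ht
  · rw [intervalIntegral.integral_const, sub_zero, sub_zero, smul_eq_mul] at hle
    refine hle.trans ?_
    gcongr
    exact ht.2
  have hsplit : F (y τ, (u + η • h) τ) - F (x τ, u τ) -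
      η • (jacA F (x τ) (u τ) (z τ) + jacB F (x τ) (u τ) (h τ)) =
      jacA F (x τ) (u τ) (y τ - x τ - η • z τ) + (F (y τ, (u + η • h) τ) - F (x τ, u τ) -
        fderiv ℝ F (x τ, u τ) ((y τ, (u + η • h) τ) - (x τ, u τ))) := by
    rw [Prod.mk_sub_mk, fderiv_apply_eq_jacA_add_jacB hFd, Pi.add_apply, Pi.smul_apply,
      add_sub_cancel_left, map_sub _ (y τ - x τ), map_smul, map_smul, smul_add]
    abel
  exact (congrArg norm hsplit).trans_le
    ((norm_add_le _ _).trans (add_le_add (hF.norm_jacA_apply_le hLF _ _ _) hτ))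

theorem IsTrajectory.hasUniformDeriv_stateTraj (hx : IsTrajectory F T x₀ u x)
    (hFd : ContDiff ℝ 1 F) (hF : JointlyLipschitz LF F) (hLF : 0 ≤ LF) (hT : 0 ≤ T)
    (hu : AdmissibleInput 0 T u) (hh : AdmissibleInput 0 T h)
    (hz : IsSolution (fun τ y => jacA F (x τ) (u τ) y + jacB F (x τ) (u τ) (h τ)) 0 T 0 z) :
    HasUniformDeriv (𝓟 (Icc 0 T)) (fun η => stateTraj F T x₀ (u + η • h)) x z := by
  obtain ⟨M, -, hM⟩ := exists_ae_bound_of_memLp_top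
    (memLp_top_prodMk (memLp_top_of_continuousOn_Icc hx.continuousOn) hu)
  obtain ⟨N, -, hN⟩ := exists_ae_bound_of_memLp_top hh
  set C := (LF * ∫ τ in (0 : ℝ)..T, ‖h τ‖) * Real.exp (LF * T)
  have hlip : ∀ η, ∀ᵐ τ ∂volume.restrict (Icc 0 T),
      ‖(stateTraj F T x₀ (u + η • h) τ, (u + η • h) τ) - (x τ, u τ)‖ ≤ max C N * |η| := fun η => by
    filter_upwards [ae_restrict_mem measurableSet_Icc, hN] with τ hτ hNτ
    refine max_le ((hx.norm_stateTraj_add_smul_sub_le hF hLF hFd.continuous hu hh η hτ).trans ?_) ?_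
    · gcongr
      exact le_max_left _ _
    · change ‖(u + η • h) τ - u τ‖ ≤ _
      simp only [Pi.add_apply, Pi.smul_apply, add_sub_cancel_left, norm_smul, Real.norm_eq_abs]
      rw [mul_comm]
      gcongr
      exact hNτ.trans (le_max_right _ _)
  intro δ hδ
  have hK : 0 < T * Real.exp (LF * T) + 1 := by positivity
  filter_upwards [HasUniformDeriv.eventually_norm_sub_sub_fderiv_le hFd hM
    (Eventually.of_forall hlip) (div_pos hδ hK)] with η hη
  refine eventually_principal.2 fun t ht => ?_
  calc _ ≤ T * (δ / (T * Real.exp (LF * T) + 1) * |η|) * Real.exp (LF * T) :=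
        hx.norm_sub_sub_smul_le hFd hF hLF hz (by positivity)
          (isTrajectory_stateTraj hF hLF hFd.continuous hT (hu.add_smul hh η) x₀) hη ht
    _ = δ * |η| * (T * Real.exp (LF * T) / (T * Real.exp (LF * T) + 1)) := by ring
    _ ≤ δ * |η| * 1 := by
        gcongr
        exact (div_le_one hK).2 (by linarith)
    _ = δ * |η| := mul_one _

end Trajectory

/-! ### The first variation of the cost -/

section Variation

variable {n m : ℕ} {F : Euc n × Euc m → Euc n} {LF T s : ℝ} {x₀ : Euc n} {u h : ℝ → Euc m}
  {x z : ℝ → Euc n} {Q : Euc n → ℝ} {R : Euc m → ℝ} {V : Euc n → ℝ}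

theorem fderiv_add_comp_apply {E U : Type*} [NormedAddCommGroup E] [NormedSpace ℝ E]
    [NormedAddCommGroup U] [NormedSpace ℝ U] {q : E → ℝ} {r : U → ℝ} (hq : Differentiable ℝ q)
    (hr : Differentiable ℝ r) (p v : E × U) :
    fderiv ℝ (fun p : E × U => q p.1 + r p.2) p v = fderiv ℝ q p.1 v.1 + fderiv ℝ r p.2 v.2 :=
  congrArg (· v) (((hq p.1).hasFDerivAt.comp p hasFDerivAt_fst).add
    ((hr p.2).hasFDerivAt.comp p hasFDerivAt_snd)).fderiv

theorem intervalIntegrable_fderiv_add_fderiv (hQ : ContDiff ℝ 1 Q) (hR : ContDiff ℝ 1 R)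
    (hx : ContinuousOn x (Icc s T)) (hz : ContinuousOn z (Icc s T)) (hu : AdmissibleInput s T u)
    (hh : AdmissibleInput s T h) (hsT : s ≤ T) :
    IntervalIntegrable (fun t => fderiv ℝ Q (x t) (z t) + fderiv ℝ R (u t) (h t)) volume s T := by
  have hG : Continuous fun p : (Euc n × Euc m) × Euc n × Euc m =>
      fderiv ℝ Q p.1.1 p.2.1 + fderiv ℝ R p.1.2 p.2.2 :=
    (((hQ.continuous_fderiv one_ne_zero).comp (by fun_prop)).clm_apply (by fun_prop)).add
      (((hR.continuous_fderiv one_ne_zero).comp (by fun_prop)).clm_apply (by fun_prop))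
  exact intervalIntegrable_of_memLp_top (memLp_top_comp hG
    (memLp_top_prodMk (memLp_top_prodMk (memLp_top_of_continuousOn_Icc hx) hu)
      (memLp_top_prodMk (memLp_top_of_continuousOn_Icc hz) hh)))
    (left_mem_Icc.2 hsT) (right_mem_Icc.2 hsT)

theorem intervalIntegrable_add_comp (hQ : Continuous Q) (hR : Continuous R)
    (hx : ContinuousOn x (Icc s T)) (hu : AdmissibleInput s T u) (hsT : s ≤ T) :
    IntervalIntegrable (fun t => Q (x t) + R (u t)) volume s T :=
  intervalIntegrable_of_memLp_top
    (memLp_top_comp (G := fun p : Euc n × Euc m => Q p.1 + R p.2) (by fun_prop)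
      (memLp_top_prodMk (memLp_top_of_continuousOn_Icc hx) hu))
    (left_mem_Icc.2 hsT) (right_mem_Icc.2 hsT)

theorem IsTrajectory.hasDerivAt_cost (hx : IsTrajectory F T x₀ u x) (hFd : ContDiff ℝ 1 F)
    (hF : JointlyLipschitz LF F) (hLF : 0 ≤ LF) (hQ : ContDiff ℝ 1 Q) (hR : ContDiff ℝ 1 R)
    (hV : ContDiff ℝ 1 V) (hT : 0 ≤ T) (hu : AdmissibleInput 0 T u) (hh : AdmissibleInput 0 T h)
    (hz : IsSolution (fun τ y => jacA F (x τ) (u τ) y + jacB F (x τ) (u τ) (h τ)) 0 T 0 z) :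
    HasDerivAt (fun η : ℝ => cost F Q R V T x₀ (u + η • h))
      ((∫ t in (0 : ℝ)..T, (fderiv ℝ Q (x t) (z t) + fderiv ℝ R (u t) (h t))) +
        fderiv ℝ V (x T) (z T)) 0 := by
  have hX := hx.hasUniformDeriv_stateTraj hFd hF hLF hT hu hh hz
  have hterm := ((hX.mono ((pure_le_principal T).2 (right_mem_Icc.2 hT))).comp hV
    (eventually_pure.2 le_rfl) (eventually_pure.2 le_rfl)).hasDerivAt
  obtain ⟨M, -, hM⟩ := exists_ae_bound_of_memLp_top
    (memLp_top_prodMk (memLp_top_of_continuousOn_Icc hx.continuousOn) hu)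
  obtain ⟨N, -, hN⟩ := exists_ae_bound_of_memLp_top
    (memLp_top_prodMk (memLp_top_of_continuousOn_Icc hz.continuousOn) hh)
  have hXae : HasUniformDeriv (ae (volume.restrict (Icc 0 T))) _ x z :=
    hX.mono (le_principal_iff.2 (ae_restrict_mem measurableSet_Icc))
  have hrun := (hXae.prodMk (.add_smul u h)).comp
    (G := fun p : Euc n × Euc m => Q p.1 + R p.2) (by fun_prop) hM hN
  simp only [fderiv_add_comp_apply (hQ.differentiable one_ne_zero)
    (hR.differentiable one_ne_zero)] at hrun
  have hint := hrun.hasDerivAt_integral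
    (fun η => integrableOn_Icc_of_intervalIntegrable hT (intervalIntegrable_add_comp hQ.continuous
      hR.continuous (isTrajectory_stateTraj hF hLF hFd.continuous hT
        (hu.add_smul hh η) x₀).continuousOn (hu.add_smul hh η) hT))
    (integrableOn_Icc_of_intervalIntegrable hT
      (intervalIntegrable_fderiv_add_fderiv hQ hR hx.continuousOn hz.continuousOn hu hh hT))
  simp only [integral_Icc_eq_integral_Ioc, ← intervalIntegral.integral_of_le hT] at hint
  exact hint.add hterm

end Variation

/-! ### Comparison of an approximate stationary point with the linearized system -/

/-- The right-hand side of the linearization of `ẋ = F(x, u)` along `(x, u)`, driven by the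
input `w`. -/
noncomputable def linearizedField {n m : ℕ} (F : Euc n × Euc m → Euc n) (x : ℝ → Euc n)
    (u w : ℝ → Euc m) (τ : ℝ) (y : Euc n) : Euc n :=
  jacA F (x τ) (u τ) y + jacB F (x τ) (u τ) (w τ) + drift F (x τ) (u τ)

section Comparison

variable {n m : ℕ} {F : Euc n × Euc m → Euc n} {LF T s : ℝ} {x₀ : Euc n}
  {u w g : ℝ → Euc m} {x y : ℝ → Euc n} {Q : Euc n → ℝ} {R : Euc m → ℝ} {V : Euc n → ℝ}
  {αQ βQ αR βR αV βV ε : ℝ}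

theorem AdmissibleInput.indicator_Ioc (hs : 0 ≤ s) (hu : AdmissibleInput s T u) :
    AdmissibleInput 0 T ((Ioc s T).indicator u) := by
  refine (memLp_indicator_iff_restrict measurableSet_Ioc).2 ?_
  rw [Measure.restrict_restrict_of_subset
    (Ioc_subset_Icc_self.trans (Icc_subset_Icc_left hs))]
  exact MemLp.mono_measure (Measure.restrict_mono Ioc_subset_Icc_self le_rfl) hu

theorem IsSolution.extend_sub_trajectory (hx : IsTrajectory F T x₀ u x) (hs : s ∈ Icc 0 T)
    (hy : IsSolution (linearizedField F x u w) s T (x s) y) :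
    IsSolution (fun τ v => jacA F (x τ) (u τ) v +
      jacB F (x τ) (u τ) ((Ioc s T).indicator (w - u) τ)) 0 T 0 fun t => (y - x) (max s t) := by
  have hsub := hy.sub (IsSolution.restrict hx hs)
  rw [sub_self] at hsub
  refine hsub.extend_zero hs (fun τ hτ => ?_) fun τ hτ => ?_
  · rw [indicator_of_notMem fun hmem => hτ.2.not_gt hmem.1, map_zero, map_zero, add_zero]
  · simp only [indicator_of_mem hτ, linearizedField, drift, Pi.sub_apply, map_sub]
    abel

theorem integral_eq_integral_of_eqOn {f k : ℝ → ℝ} {a b : ℝ} (hs : s ∈ Icc a b)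
    (hf : ∀ t ∈ Ioc a s, f t = 0) (hfk : EqOn f k (Ioc s b)) :
    ∫ t in a..b, f t = ∫ t in s..b, k t := by
  rw [intervalIntegral.integral_of_le (hs.1.trans hs.2), intervalIntegral.integral_of_le hs.2,
    ← setIntegral_congr_fun measurableSet_Ioc hfk]
  refine setIntegral_eq_of_subset_of_forall_sdiff_eq_zero measurableSet_Ioc
    (Ioc_subset_Ioc_left hs.1) fun t ht => hf t ⟨ht.1.1, ?_⟩
  exact not_lt.1 fun hst => ht.2 ⟨hst, ht.1.2⟩

theorem IsL2Gradient.integral_fderiv_add_fderiv_eq (hg : IsL2Gradient T (cost F Q R V T x₀) u g)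
    (hx : IsTrajectory F T x₀ u x) (hFd : ContDiff ℝ 1 F) (hF : JointlyLipschitz LF F)
    (hLF : 0 ≤ LF) (hQ : ContDiff ℝ 1 Q) (hR : ContDiff ℝ 1 R) (hV : ContDiff ℝ 1 V)
    (hs : s ∈ Icc 0 T) (hu : AdmissibleInput 0 T u) (hw : AdmissibleInput s T w)
    (hy : IsSolution (linearizedField F x u w) s T (x s) y) :
    (∫ t in s..T, (fderiv ℝ Q (x t) (y t - x t) + fderiv ℝ R (u t) (w t - u t))) +
      fderiv ℝ V (x T) (y T - x T) = ∫ t in s..T, inner ℝ (g t) (w t - u t) := by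
  have hh : AdmissibleInput 0 T ((Ioc s T).indicator (w - u)) :=
    .indicator_Ioc hs.1 (MemLp.sub hw (hu.mono (Icc_subset_Icc_left hs.1)))
  have heq := (hx.hasDerivAt_cost hFd hF hLF hQ hR hV (hs.1.trans hs.2) hu hh
    (hy.extend_sub_trajectory hx hs)).unique (hg.hasDerivAt _ hh)
  have hind : ∀ t ∈ Ioc 0 s, (Ioc s T).indicator (w - u) t = 0 := fun t ht =>
    indicator_of_notMem (fun hmem => ht.2.not_gt hmem.1) _
  have hys : y s - x s = 0 := sub_eq_zero.2 (hy.eq_initial hs.2)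
  rw [integral_eq_integral_of_eqOn hs
      (k := fun t => fderiv ℝ Q (x t) (y t - x t) + fderiv ℝ R (u t) (w t - u t))
      (fun t ht => by simp [max_eq_left ht.2, hys, hind t ht])
      fun t ht => by simp [indicator_of_mem ht, max_eq_right ht.1.le],
    integral_eq_integral_of_eqOn hs (k := fun t => inner ℝ (g t) (w t - u t))
      (fun t ht => by simp [hind t ht]) fun t ht => by simp [indicator_of_mem ht],
    max_eq_right hs.2] at heq
  exact heq

theorem neg_inner_le_norm_sq_div_add {H : Type*} [NormedAddCommGroup H] [InnerProductSpace ℝ H]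
    {α : ℝ} (hα : 0 < α) (a b : H) :
    -inner ℝ a b ≤ ‖a‖ ^ 2 / (2 * α) + α / 2 * ‖b‖ ^ 2 := by
  have hsq : 0 ≤ ‖a + α • b‖ ^ 2 / (2 * α) := by positivity
  rw [norm_add_sq_real, inner_smul_right, norm_smul, Real.norm_of_nonneg hα.le] at hsq
  have hexpand : (‖a‖ ^ 2 + 2 * (α * inner ℝ a b) + (α * ‖b‖) ^ 2) / (2 * α) =
      ‖a‖ ^ 2 / (2 * α) + inner ℝ a b + α / 2 * ‖b‖ ^ 2 := by field_simp
  linarith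

theorem integral_norm_sq_le_of_eLpNorm_toReal_le {α E : Type*} [MeasurableSpace α]
    {μ : Measure α} [NormedAddCommGroup E] {f : α → E} {ε : ℝ} (hf : MemLp f 2 μ)
    (hε : (eLpNorm f 2 μ).toReal ≤ ε) : ∫ a, ‖f a‖ ^ 2 ∂μ ≤ ε ^ 2 := by
  have hnn : 0 ≤ ∫ a, ‖f a‖ ^ 2 ∂μ := integral_nonneg fun _ => sq_nonneg _
  rw [hf.eLpNorm_eq_integral_rpow_norm two_ne_zero ENNReal.ofNat_ne_top,
    ENNReal.toReal_ofReal (by positivity)] at hε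
  simp only [ENNReal.toReal_ofNat, Real.rpow_ofNat, ← one_div, ← Real.sqrt_eq_rpow] at hε
  exact (Real.sqrt_le_left ((Real.sqrt_nonneg _).trans hε)).1 hε

theorem intervalIntegral_norm_sq_le_of_eLpNorm_toReal_le
    (hg : MemLp g 2 (volume.restrict (Icc 0 T)))
    (hε : (eLpNorm g 2 (volume.restrict (Icc 0 T))).toReal ≤ ε) (hs : s ∈ Icc 0 T) :
    ∫ t in s..T, ‖g t‖ ^ 2 ≤ ε ^ 2 := by
  have hle : volume.restrict (Icc s T) ≤ volume.restrict (Icc 0 T) :=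
    Measure.restrict_mono (Icc_subset_Icc_left hs.1) le_rfl
  rw [intervalIntegral.integral_of_le hs.2, ← integral_Icc_eq_integral_Ioc]
  exact integral_norm_sq_le_of_eLpNorm_toReal_le (hg.mono_measure hle)
    ((ENNReal.toReal_mono hg.eLpNorm_ne_top (eLpNorm_mono_measure _ hle)).trans hε)

/- The strong convexity of `R` absorbs the error `⟪g, w - u⟫` of the stationarity condition: this
is where `ε ^ 2 / (2 * αR)` comes from. -/
theorem IsFOS.integral_add_le_linearized (hu : IsFOS T ε (cost F Q R V T x₀) u)
    (hx : IsTrajectory F T x₀ u x) (hFd : ContDiff ℝ 1 F) (hF : JointlyLipschitz LF F)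
    (hLF : 0 ≤ LF) (hαQ : 0 ≤ αQ) (hQ : IsCost αQ βQ Q) (hαR : 0 < αR) (hR : IsCost αR βR R)
    (hαV : 0 ≤ αV) (hV : IsCost αV βV V) (hs : s ∈ Icc 0 T) (hw : AdmissibleInput s T w)
    (hy : IsSolution (linearizedField F x u w) s T (x s) y) :
    (∫ t in s..T, (Q (x t) + R (u t))) + V (x T) ≤
      (∫ t in s..T, (Q (y t) + R (w t))) + V (y T) + ε ^ 2 / (2 * αR) := by
  obtain ⟨hua, g, hg, hgε⟩ := hu
  have hsub : Icc s T ⊆ Icc 0 T := Icc_subset_Icc_left hs.1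
  have hxs := hx.continuousOn.mono hsub
  have hus := hua.mono hsub
  have hgs := hg.memLp.mono_measure (Measure.restrict_mono hsub le_rfl)
  have hgrad := hg.integral_fderiv_add_fderiv_eq hx hFd hF hLF hQ.contDiff_one hR.contDiff_one
    hV.contDiff_one hs hua hw hy
  have hint_x := intervalIntegrable_add_comp hQ.contDiff.continuous hR.contDiff.continuous hxs hus
    hs.2
  have hint_y := intervalIntegrable_add_comp hQ.contDiff.continuous hR.contDiff.continuous
    hy.continuousOn hw hs.2
  have hint_d : IntervalIntegrable (fun t => fderiv ℝ Q (x t) (y t - x t) +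
      fderiv ℝ R (u t) (w t - u t)) volume s T :=
    intervalIntegrable_fderiv_add_fderiv hQ.contDiff_one hR.contDiff_one hxs
      (hy.continuousOn.sub hxs) hus (MemLp.sub hw hus) hs.2
  have hint_i : IntervalIntegrable (fun t => inner ℝ (g t) (w t - u t)) volume s T :=
    intervalIntegrable_of_integrableOn_Icc (integrable_inner_of_memLp_two hgs
      ((MemLp.sub hw hus).mono_exponent le_top)) (left_mem_Icc.2 hs.2) (right_mem_Icc.2 hs.2)
  have hint_g : IntervalIntegrable (fun t => ‖g t‖ ^ 2 / (2 * αR)) volume s T :=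
    (intervalIntegrable_of_integrableOn_Icc (hgs.integrable_norm_pow two_ne_zero)
      (left_mem_Icc.2 hs.2) (right_mem_Icc.2 hs.2)).div_const _
  have hmono := intervalIntegral.integral_mono_on hs.2 ((hint_x.add hint_d).sub hint_i)
    (hint_y.add hint_g) fun t _ => by
      linarith [hQ.add_fderiv_le hαQ (x t) (y t), hR.add_fderiv_add_le (u t) (w t),
        neg_inner_le_norm_sq_div_add hαR (g t) (w t - u t)]
  rw [intervalIntegral.integral_sub (hint_x.add hint_d) hint_i,
    intervalIntegral.integral_add hint_x hint_d, intervalIntegral.integral_add hint_y hint_g,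
    intervalIntegral.integral_div] at hmono
  have hgsq : (∫ t in s..T, ‖g t‖ ^ 2) / (2 * αR) ≤ ε ^ 2 / (2 * αR) := by
    gcongr
    exact intervalIntegral_norm_sq_le_of_eLpNorm_toReal_le hg.memLp hgε hs
  linarith [hV.add_fderiv_le hαV (x T) (y T)]

end Comparison

/-! ### The energy of an approximate stationary point -/

/-- The energy density `‖x‖² + ρ ‖u‖²`, whose integral is controlled along an approximate
stationary point for `ρ = αR / αQ`. -/
noncomputable def energyDensity {n m : ℕ} (ρ : ℝ) (x : ℝ → Euc n) (u : ℝ → Euc m) (t : ℝ) : ℝ :=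
  ‖x t‖ ^ 2 + ρ * ‖u t‖ ^ 2

/-- The relative size `θ` of the drift, in terms of which `constC2 = (1 + θ) / (2 * αR * αQ)`. -/
noncomputable def driftRatio (αQ αR βR Lx Lu : ℝ) : ℝ :=
  8 * βR * max (Lx ^ 2 / αQ) (Lu ^ 2 / αR)

section Constants

variable {γ αQ αR βQ βR βV Lx Lu : ℝ}

theorem driftRatio_nonneg (hαQ : 0 ≤ αQ) (hβR : 0 ≤ βR) : 0 ≤ driftRatio αQ αR βR Lx Lu :=
  mul_nonneg (by positivity) (le_max_of_le_left (by positivity))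

theorem driftRatio_le_one (hαQ : 0 < αQ) (hαR : 0 < αR) (hβR : 0 < βR)
    (hLu : Lu ^ 2 ≤ αR / (8 * βR)) (hLx : Lx ^ 2 ≤ αQ / (8 * βR)) :
    driftRatio αQ αR βR Lx Lu ≤ 1 := by
  rw [driftRatio, ← le_div_iff₀' (by positivity)]
  refine max_le ?_ ?_
  · rwa [div_le_iff₀ hαQ, one_div_mul_eq_div]
  · rwa [div_le_iff₀ hαR, one_div_mul_eq_div]

theorem mul_sq_le_driftRatio_mul (hαQ : 0 < αQ) (hαR : 0 < αR) (hβR : 0 ≤ βR) {a b c : ℝ}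
    (hc₀ : 0 ≤ c) (hc : c ≤ Lx * a + Lu * b) :
    βR * c ^ 2 ≤ driftRatio αQ αR βR Lx Lu / 4 * (αQ * a ^ 2 + αR * b ^ 2) := by
  have hLx : Lx ^ 2 ≤ max (Lx ^ 2 / αQ) (Lu ^ 2 / αR) * αQ :=
    (div_le_iff₀ hαQ).1 (le_max_left _ _)
  have hLu : Lu ^ 2 ≤ max (Lx ^ 2 / αQ) (Lu ^ 2 / αR) * αR :=
    (div_le_iff₀ hαR).1 (le_max_right _ _)
  calc βR * c ^ 2 ≤ βR * (2 * ((Lx * a) ^ 2 + (Lu * b) ^ 2)) := by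
        gcongr
        exact (pow_le_pow_left₀ hc₀ hc 2).trans add_sq_le
    _ = 2 * βR * (Lx ^ 2 * a ^ 2 + Lu ^ 2 * b ^ 2) := by ring
    _ ≤ 2 * βR * (max (Lx ^ 2 / αQ) (Lu ^ 2 / αR) * αQ * a ^ 2 +
        max (Lx ^ 2 / αQ) (Lu ^ 2 / αR) * αR * b ^ 2) := by gcongr
    _ = _ := by rw [driftRatio]; ring

theorem constC1_pos (hγ : 0 < γ) (hαQ : 0 < αQ) (hβR : 0 < βR) :
    0 < constC1 γ αQ βQ βR βV := by
  have : 0 < max βV (max βR βQ) := lt_max_of_lt_right (lt_max_of_lt_left hβR)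
  unfold constC1
  positivity

theorem constC2_nonneg (hαQ : 0 ≤ αQ) (hαR : 0 ≤ αR) (hβR : 0 ≤ βR) :
    0 ≤ constC2 αQ αR βR Lx Lu :=
  mul_nonneg (by positivity)
    (add_nonneg zero_le_one (driftRatio_nonneg (Lx := Lx) (Lu := Lu) hαQ hβR))

theorem four_mul_le_constC1 (hγ : 0 ≤ γ) (hαQ : 0 < αQ) (hαβQ : αQ ≤ βQ) :
    4 * γ ≤ constC1 γ αQ βQ βR βV := by
  rw [constC1, le_div_iff₀ hαQ]
  gcongr
  exact hαβQ.trans ((le_max_right _ _).trans (le_max_right _ _))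

theorem four_mul_mul_div_le_constC1 (hγ : 0 ≤ γ) (hαQ : 0 ≤ αQ) (hαβR : αR ≤ βR) :
    4 * γ * (αR / αQ) ≤ constC1 γ αQ βQ βR βV := by
  rw [constC1, ← mul_div_assoc]
  gcongr
  exact hαβR.trans ((le_max_left _ _).trans (le_max_right _ _))

end Constants

theorem IsStabilizable.exists_lt {n m : ℕ} {γ T s c : ℝ} {A : ℝ → Euc n →L[ℝ] Euc n}
    {B : ℝ → Euc m →L[ℝ] Euc n} (h : IsStabilizable γ T A B) (hs : s ∈ Icc 0 T) {ξ : Euc n}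
    (hc : γ * ‖ξ‖ ^ 2 < c) :
    ∃ v z, AdmissibleInput s T v ∧ IsSolution (fun τ y => A τ y + B τ (v τ)) s T ξ z ∧
      (∫ t in s..T, (‖z t‖ ^ 2 + ‖v t‖ ^ 2)) + ‖z T‖ ^ 2 < c := by
  have hlt := (h s hs ξ).trans_lt (EReal.coe_lt_coe_iff.2 hc)
  simp only [iInf_lt_iff] at hlt
  obtain ⟨v, z, hv, hz, hlt⟩ := hlt
  exact ⟨v, z, hv, hz, EReal.coe_lt_coe_iff.1 hlt⟩

section Energy

variable {n m : ℕ} {F : Euc n × Euc m → Euc n} {LF T s ρ : ℝ} {x₀ : Euc n}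
  {u v p : ℝ → Euc m} {x z : ℝ → Euc n} {Q : Euc n → ℝ} {R : Euc m → ℝ} {V : Euc n → ℝ}
  {αQ βQ αR βR αV βV γ Lx Lu ε b : ℝ}

theorem admissibleInput_pinv_drift (hF : ContDiff ℝ 1 F) (hx : ContinuousOn x (Icc 0 T))
    (hu : AdmissibleInput 0 T u)
    (hp : ∀ t ∈ Icc 0 T,
      ‖pinv (jacB F (x t) (u t)) (drift F (x t) (u t))‖ ≤ Lx * ‖x t‖ + Lu * ‖u t‖) :
    AdmissibleInput 0 T fun t => pinv (jacB F (x t) (u t)) (drift F (x t) (u t)) := by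
  obtain ⟨D, hD⟩ := isCompact_Icc.exists_bound_of_continuousOn hx
  obtain ⟨M, -, hM⟩ := exists_ae_bound_of_memLp_top hu
  have hmeas := (measurable_pinv (continuous_jacB hF) (continuous_drift hF)).comp_aemeasurable
    ((hx.aestronglyMeasurable measurableSet_Icc).aemeasurable.prodMk hu.1.aemeasurable)
  refine memLp_top_of_bound hmeas.aestronglyMeasurable (|Lx| * D + |Lu| * M) ?_
  filter_upwards [hM, ae_restrict_mem measurableSet_Icc] with t hut ht
  calc _ ≤ Lx * ‖x t‖ + Lu * ‖u t‖ := hp t ht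
    _ ≤ |Lx| * ‖x t‖ + |Lu| * ‖u t‖ := by gcongr <;> exact le_abs_self _
    _ ≤ |Lx| * D + |Lu| * M := by gcongr; exact hD t ht

theorem energyDensity_nonneg (hρ : 0 ≤ ρ) (t : ℝ) : 0 ≤ energyDensity ρ x u t := by
  unfold energyDensity
  positivity

theorem norm_sq_le_energyDensity (hρ : 0 ≤ ρ) (t : ℝ) : ‖x t‖ ^ 2 ≤ energyDensity ρ x u t :=
  le_add_of_nonneg_right (by positivity)

theorem integrableOn_energyDensity (hx : ContinuousOn x (Icc s T)) (hu : AdmissibleInput s T u)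
    (hsT : s ≤ T) : IntegrableOn (energyDensity ρ x u) (Icc s T) :=
  integrableOn_Icc_of_intervalIntegrable hsT
    (intervalIntegrable_add_comp (Q := fun y : Euc n => ‖y‖ ^ 2)
      (R := fun w : Euc m => ρ * ‖w‖ ^ 2) (by fun_prop) (by fun_prop) hx hu hsT)

theorem intervalIntegrable_energyDensity (hx : ContinuousOn x (Icc s T))
    (hu : AdmissibleInput s T u) (hsT : s ≤ T) :
    IntervalIntegrable (energyDensity ρ x u) volume s T :=
  intervalIntegrable_of_integrableOn_Icc (integrableOn_energyDensity hx hu hsT)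
    (left_mem_Icc.2 hsT) (right_mem_Icc.2 hsT)

theorem IsCost.half_mul_integral_energyDensity_le (hQ : IsCost αQ βQ Q) (hR : IsCost αR βR R)
    (hαQ : αQ ≠ 0) (hx : ContinuousOn x (Icc s T)) (hu : AdmissibleInput s T u) (hsT : s ≤ T) :
    αQ / 2 * ∫ t in s..T, energyDensity (αR / αQ) x u t ≤ ∫ t in s..T, (Q (x t) + R (u t)) := by
  rw [← intervalIntegral.integral_const_mul]
  refine intervalIntegral.integral_mono_on hsT
    ((intervalIntegrable_energyDensity hx hu hsT).const_mul _)
    (intervalIntegrable_add_comp hQ.contDiff.continuous hR.contDiff.continuous hx hu hsT)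
    fun t _ => ?_
  calc αQ / 2 * energyDensity (αR / αQ) x u t = αQ / 2 * ‖x t‖ ^ 2 + αR / 2 * ‖u t‖ ^ 2 := by
        rw [energyDensity]; field_simp
    _ ≤ _ := add_le_add (hQ.half_mul_norm_sq_le _) (hR.half_mul_norm_sq_le _)

theorem IsCost.add_sub_le (hQ : IsCost αQ βQ Q) (hR : IsCost αR βR R) (hβR : 0 ≤ βR)
    (hβRb : βR ≤ b) (hβQb : βQ ≤ b) (y : Euc n) (v p : Euc m) :
    Q y + R (v - p) ≤ b * (‖y‖ ^ 2 + ‖v‖ ^ 2) + βR * ‖p‖ ^ 2 := by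
  have hsq : ‖v - p‖ ^ 2 ≤ 2 * (‖v‖ ^ 2 + ‖p‖ ^ 2) :=
    (pow_le_pow_left₀ (norm_nonneg _) (norm_sub_le _ _) 2).trans add_sq_le
  calc Q y + R (v - p) ≤ βQ / 2 * ‖y‖ ^ 2 + βR / 2 * ‖v - p‖ ^ 2 :=
        add_le_add (hQ.le_half_mul_norm_sq _) (hR.le_half_mul_norm_sq _)
    _ ≤ b * ‖y‖ ^ 2 + βR / 2 * (2 * (‖v‖ ^ 2 + ‖p‖ ^ 2)) := by gcongr; linarith
    _ = b * ‖y‖ ^ 2 + βR * ‖v‖ ^ 2 + βR * ‖p‖ ^ 2 := by ring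
    _ ≤ b * ‖y‖ ^ 2 + b * ‖v‖ ^ 2 + βR * ‖p‖ ^ 2 := by gcongr
    _ = _ := by ring

theorem IsCost.integral_add_sub_le (hQ : IsCost αQ βQ Q) (hR : IsCost αR βR R) (hαQ : 0 < αQ)
    (hαR : 0 < αR) (hβR : 0 ≤ βR) (hβRb : βR ≤ b) (hβQb : βQ ≤ b)
    (hx : ContinuousOn x (Icc s T)) (hu : AdmissibleInput s T u) (hz : ContinuousOn z (Icc s T))
    (hv : AdmissibleInput s T v) (hp : AdmissibleInput s T p)
    (hpn : ∀ t ∈ Icc s T, ‖p t‖ ≤ Lx * ‖x t‖ + Lu * ‖u t‖) (hsT : s ≤ T) :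
    ∫ t in s..T, (Q (z t) + R ((v - p) t)) ≤ b * (∫ t in s..T, (‖z t‖ ^ 2 + ‖v t‖ ^ 2)) +
      driftRatio αQ αR βR Lx Lu / 4 * αQ * ∫ t in s..T, energyDensity (αR / αQ) x u t := by
  have hint_z := (intervalIntegrable_add_comp (Q := fun y : Euc n => ‖y‖ ^ 2)
    (R := fun w : Euc m => ‖w‖ ^ 2) (by fun_prop) (by fun_prop) hz hv hsT).const_mul b
  have hint_x := (intervalIntegrable_energyDensity (ρ := αR / αQ) hx hu hsT).const_mul
    (driftRatio αQ αR βR Lx Lu / 4 * αQ)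
  rw [← intervalIntegral.integral_const_mul, ← intervalIntegral.integral_const_mul,
    ← intervalIntegral.integral_add hint_z hint_x]
  refine intervalIntegral.integral_mono_on hsT (intervalIntegrable_add_comp
    hQ.contDiff.continuous hR.contDiff.continuous hz (MemLp.sub hv hp) hsT)
    (hint_z.add hint_x) fun t ht => ?_
  calc Q (z t) + R (v t - p t) ≤ b * (‖z t‖ ^ 2 + ‖v t‖ ^ 2) + βR * ‖p t‖ ^ 2 :=
        hQ.add_sub_le hR hβR hβRb hβQb _ _ _
    _ ≤ b * (‖z t‖ ^ 2 + ‖v t‖ ^ 2) +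
        driftRatio αQ αR βR Lx Lu / 4 * (αQ * ‖x t‖ ^ 2 + αR * ‖u t‖ ^ 2) :=
      add_le_add le_rfl (mul_sq_le_driftRatio_mul hαQ hαR hβR (norm_nonneg _) (hpn t ht))
    _ = _ := by rw [energyDensity]; field_simp

theorem IsSolution.linearizedField_sub {ξ : Euc n}
    (hz : IsSolution (fun t y => jacA F (x t) (u t) y + jacB F (x t) (u t) (v t)) s T ξ z)
    (hsT : s ≤ T) (hp : ∀ t ∈ Icc s T, jacB F (x t) (u t) (p t) = drift F (x t) (u t)) :
    IsSolution (linearizedField F x u (v - p)) s T ξ z := by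
  refine hz.congr hsT fun t ht => ?_
  rw [linearizedField, ← hp t (Ioc_subset_Icc_self ht), Pi.sub_apply, map_sub]
  abel

/- The competitor is the input `v - p`: by the matching condition the matching input `p` cancels
the drift, so the linearized system follows the linear one. -/
theorem IsFOS.mul_integral_energyDensity_le (hu : IsFOS T ε (cost F Q R V T x₀) u)
    (hx : IsTrajectory F T x₀ u x) (hFd : ContDiff ℝ 1 F) (hF : JointlyLipschitz LF F)
    (hLF : 0 ≤ LF) (hαQ : 0 < αQ) (hQ : IsCost αQ βQ Q) (hαR : 0 < αR) (hβR : 0 ≤ βR)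
    (hR : IsCost αR βR R) (hαV : 0 ≤ αV) (hV : IsCost αV βV V) (hβVb : βV ≤ b) (hβRb : βR ≤ b)
    (hβQb : βQ ≤ b) (hp : AdmissibleInput 0 T p)
    (hmatch : ∀ t ∈ Icc 0 T, jacB F (x t) (u t) (p t) = drift F (x t) (u t))
    (hpn : ∀ t ∈ Icc 0 T, ‖p t‖ ≤ Lx * ‖x t‖ + Lu * ‖u t‖) (hs : s ∈ Icc 0 T)
    (hv : AdmissibleInput s T v)
    (hz : IsSolution (fun t y => jacA F (x t) (u t) y + jacB F (x t) (u t) (v t)) s T (x s) z) :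
    (1 / 2 - driftRatio αQ αR βR Lx Lu / 4) * αQ *
        (∫ t in s..T, energyDensity (αR / αQ) x u t) + αV / 2 * ‖x T‖ ^ 2 ≤
      b * ((∫ t in s..T, (‖z t‖ ^ 2 + ‖v t‖ ^ 2)) + ‖z T‖ ^ 2) + ε ^ 2 / (2 * αR) := by
  have hsub : Icc s T ⊆ Icc 0 T := Icc_subset_Icc_left hs.1
  have hxs := hx.continuousOn.mono hsub
  have hus := hu.1.mono hsub
  have hps := hp.mono hsub
  have hcompare := hu.integral_add_le_linearized hx hFd hF hLF hαQ.le hQ hαR hR hαV hV hs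
    (MemLp.sub hv hps) (hz.linearizedField_sub hs.2 fun t ht => hmatch t (hsub ht))
  have hlower := hQ.half_mul_integral_energyDensity_le hR hαQ.ne' hxs hus hs.2
  have hupper := hQ.integral_add_sub_le hR hαQ hαR hβR hβRb hβQb hxs hus hz.continuousOn hv hps
    (fun t ht => hpn t (hsub ht)) hs.2
  have hVz : V (z T) ≤ b * ‖z T‖ ^ 2 :=
    (hV.le_half_mul_norm_sq _).trans (by gcongr; linarith)
  linarith [hV.half_mul_norm_sq_le (x T)]

theorem add_le_of_half_sub_mul_add_le {θ W Z B E : ℝ} (hθ₀ : 0 ≤ θ) (hθ₁ : θ ≤ 1) (hW : 0 ≤ W)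
    (hZ : 0 ≤ Z) (hB : 0 ≤ B) (h : (1 / 2 - θ / 4) * W + 1 / 2 * Z ≤ B + E) :
    W + Z ≤ 4 * B + 2 * ((1 + θ) * E) := by
  have hmul := mul_le_mul_of_nonneg_left h (by positivity : 0 ≤ 2 * (1 + θ))
  linarith [mul_nonneg (mul_nonneg hθ₀ (sub_nonneg.2 hθ₁)) hW, mul_nonneg hθ₀ hZ,
    mul_nonneg (sub_nonneg.2 hθ₁) hB]

theorem IsFOS.integral_energyDensity_add_le (hu : IsFOS T ε (cost F Q R V T x₀) u)
    (hx : IsTrajectory F T x₀ u x) (hFd : ContDiff ℝ 1 F) (hF : JointlyLipschitz LF F)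
    (hLF : 0 ≤ LF) (hαQ : 0 < αQ) (hQ : IsCost αQ βQ Q) (hαR : 0 < αR) (hβR : 0 < βR)
    (hR : IsCost αR βR R) (hαV : 0 ≤ αV) (hV : IsCost αV βV V) (hγ : 0 ≤ γ)
    (hLu : Lu ^ 2 ≤ αR / (8 * βR)) (hLx : Lx ^ 2 ≤ αQ / (8 * βR))
    (hstab : IsStabilizable γ T (fun t => jacA F (x t) (u t)) fun t => jacB F (x t) (u t))
    (hp : AdmissibleInput 0 T p)
    (hmatch : ∀ t ∈ Icc 0 T, jacB F (x t) (u t) (p t) = drift F (x t) (u t))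
    (hpn : ∀ t ∈ Icc 0 T, ‖p t‖ ≤ Lx * ‖x t‖ + Lu * ‖u t‖) (hs : s ∈ Icc 0 T) :
    (∫ t in s..T, energyDensity (αR / αQ) x u t) + αV / αQ * ‖x T‖ ^ 2 ≤
      constC1 γ αQ βQ βR βV * ‖x s‖ ^ 2 + 2 * (constC2 αQ αR βR Lx Lu * ε ^ 2) := by
  set b := max βV (max βR βQ) with hb
  have hβRb : βR ≤ b := (le_max_left _ _).trans (le_max_right _ _)
  have hb₀ : 0 < b := hβR.trans_le hβRb
  set θ := driftRatio αQ αR βR Lx Lu with hθ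
  set W := ∫ t in s..T, energyDensity (αR / αQ) x u t
  have hW : 0 ≤ W :=
    intervalIntegral.integral_nonneg hs.2 fun t _ => energyDensity_nonneg (by positivity) t
  have henergy : (1 / 2 - θ / 4) * αQ * W + αV / 2 * ‖x T‖ ^ 2 ≤
      b * (γ * ‖x s‖ ^ 2) + ε ^ 2 / (2 * αR) := by
    refine le_of_forall_pos_le_add fun η hη => ?_
    obtain ⟨v, z, hv, hz, hlt⟩ :=
      hstab.exists_lt hs (lt_add_of_pos_right (γ * ‖x s‖ ^ 2) (div_pos hη hb₀))
    have hle := hu.mul_integral_energyDensity_le hx hFd hF hLF hαQ hQ hαR hβR.le hR hαV hV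
      (le_max_left _ _) hβRb ((le_max_right _ _).trans (le_max_right _ _)) hp hmatch hpn hs hv hz
    have hlt' := mul_le_mul_of_nonneg_left hlt.le hb₀.le
    rw [mul_add b (γ * _), mul_div_cancel₀ _ hb₀.ne'] at hlt'
    linarith
  have hscaled : (1 / 2 - θ / 4) * W + 1 / 2 * (αV / αQ * ‖x T‖ ^ 2) ≤
      γ * b / αQ * ‖x s‖ ^ 2 + ε ^ 2 / (2 * αR * αQ) := by
    calc _ = ((1 / 2 - θ / 4) * αQ * W + αV / 2 * ‖x T‖ ^ 2) / αQ := by field_simp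
      _ ≤ (b * (γ * ‖x s‖ ^ 2) + ε ^ 2 / (2 * αR)) / αQ := by gcongr
      _ = _ := by field_simp
  refine (add_le_of_half_sub_mul_add_le (driftRatio_nonneg hαQ.le hβR.le)
    (driftRatio_le_one hαQ hαR hβR hLu hLx) hW (by positivity) (by positivity) hscaled).trans_eq ?_
  rw [constC1, constC2, ← hb, ← driftRatio, ← hθ]
  ring

end Energy

/-! ### Exponential decay from tail estimates -/

/-- The estimates on `[0, T]` from which decay of `q` is deduced: `w` dominates `q ≥ 0`, the
increments of `q` are controlled by the integral of `w`, and the tail integral of `w`, together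
with the terminal term `σ * q T`, is controlled by the current value of `q` up to the error `2 * E`.
In the application `q = ‖x‖²` and `w` is the energy density. -/
structure HasTailEstimate (T K C σ E : ℝ) (q w : ℝ → ℝ) : Prop where
  integrableOn : IntegrableOn w (Icc 0 T)
  nonneg : ∀ t ∈ Icc 0 T, 0 ≤ q t
  le : ∀ t ∈ Icc 0 T, q t ≤ w t
  abs_sub_le : ∀ a ∈ Icc 0 T, ∀ b ∈ Icc a T, |q b - q a| ≤ K * ∫ t in a..b, w t
  tail_le : ∀ s ∈ Icc 0 T, (∫ t in s..T, w t) + σ * q T ≤ C * q s + 2 * E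

namespace HasTailEstimate

variable {T K C σ E s : ℝ} {q w : ℝ → ℝ}

theorem ae_nonneg (h : HasTailEstimate T K C σ E q w) : 0 ≤ᵐ[volume.restrict (Icc 0 T)] w :=
  (ae_restrict_mem measurableSet_Icc).mono fun t ht => (h.nonneg t ht).trans (h.le t ht)

theorem integral_add_le_exp (h : HasTailEstimate T K C σ E q w) (hC : 0 < C) (hs : s ∈ Icc 0 T) :
    (∫ t in s..T, w t) + σ * q T ≤ C * Real.exp (-(s / C)) * q 0 + 2 * E := by
  have hint : ∀ a ∈ Icc 0 T, ∀ b ∈ Icc 0 T, IntervalIntegrable w volume a b :=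
    fun a ha b hb => intervalIntegrable_of_integrableOn_Icc h.integrableOn ha hb
  have hT : T ∈ Icc 0 T := ⟨hs.1.trans hs.2, le_rfl⟩
  set Y : ℝ → ℝ := fun r => (∫ t in r..T, w t) + σ * q T - 2 * E with hY
  have hYcont : ContinuousOn Y (Icc 0 s) := by
    have hprim := intervalIntegral.continuousOn_primitive_interval_left
      (h.integrableOn.mono_set (uIcc_of_le hT.1).subset)
    exact ((hprim.mono (by rw [uIcc_of_le hT.1]; exact Icc_subset_Icc_right hs.2)).add
      continuousOn_const).sub continuousOn_const
  have hYq : ∀ t ∈ Icc 0 T, C⁻¹ * Y t ≤ q t := fun t ht => by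
    rw [inv_mul_le_iff₀ hC]
    linarith [h.tail_le t ht]
  have hYs : Y s * Real.exp (C⁻¹ * (s - 0)) ≤ Y 0 := by
    refine mul_exp_le_of_add_mul_integral_le (inv_nonneg.2 hC.le) hs.1 hYcont fun r hr => ?_
    have hrT : r ∈ Icc 0 T := ⟨hr.1, hr.2.trans hs.2⟩
    rw [← intervalIntegral.integral_const_mul]
    have hmono := intervalIntegral.integral_mono_on hr.2 ((intervalIntegrable_of_integrableOn_Icc
      hYcont.integrableOn_Icc hr (right_mem_Icc.2 hs.1)).const_mul C⁻¹) (hint r hrT s hs)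
      fun t ht => (hYq t ⟨hr.1.trans ht.1, ht.2.trans hs.2⟩).trans
        (h.le t ⟨hr.1.trans ht.1, ht.2.trans hs.2⟩)
    simp only [hY] at hmono ⊢
    rw [← intervalIntegral.integral_add_adjacent_intervals (hint r hrT s hs) (hint s hs T hT)]
    linarith
  have hY₀ : Y 0 ≤ C * q 0 := (inv_mul_le_iff₀ hC).1 (hYq 0 ⟨le_rfl, hT.1⟩)
  rw [sub_zero, inv_mul_eq_div, ← le_div_iff₀ (Real.exp_pos _), div_eq_mul_inv,
    ← Real.exp_neg] at hYs
  have hdecay := hYs.trans (mul_le_mul_of_nonneg_right hY₀ (Real.exp_pos _).le)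
  simp only [hY] at hdecay
  linarith

theorem le_of_terminal (h : HasTailEstimate T K C σ E q w) (hK : 0 ≤ K) (hC : 0 < C) (hσ : 0 < σ)
    (hs : s ∈ Icc 0 T) : q s ≤ 2 * (K + 1 / σ) * (C * Real.exp (-(s / C)) * q 0 + E) := by
  have hT : T ∈ Icc s T := ⟨hs.2, le_rfl⟩
  have h₀ : 0 ∈ Icc 0 T := ⟨le_rfl, hs.1.trans hs.2⟩
  have hq₀ := h.nonneg 0 h₀
  have hqT := h.nonneg T ⟨h₀.2, le_rfl⟩
  have hvar := (neg_le_abs _).trans (h.abs_sub_le s hs T hT)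
  have htail : 0 ≤ ∫ t in s..T, w t := intervalIntegral.integral_nonneg hs.2 fun t ht =>
    (h.nonneg t ⟨hs.1.trans ht.1, ht.2⟩).trans (h.le t ⟨hs.1.trans ht.1, ht.2⟩)
  calc q s ≤ K * (∫ t in s..T, w t) + q T := by linarith
    _ ≤ K * (∫ t in s..T, w t) + q T + (1 / σ * (∫ t in s..T, w t) + K * (σ * q T)) :=
      le_add_of_nonneg_right (by positivity)
    _ = (K + 1 / σ) * ((∫ t in s..T, w t) + σ * q T) := by field_simp; ring
    _ ≤ (K + 1 / σ) * (C * Real.exp (-(s / C)) * q 0 + 2 * E) :=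
      mul_le_mul_of_nonneg_left (h.integral_add_le_exp hC hs) (by positivity)
    _ ≤ (K + 1 / σ) * (2 * (C * Real.exp (-(s / C)) * q 0 + E)) := by
      have : 0 ≤ C * Real.exp (-(s / C)) * q 0 := by positivity
      gcongr
      linarith
    _ = _ := by ring

theorem le_initial (h : HasTailEstimate T K C σ E q w) (hK : 0 ≤ K) (hσ : 0 ≤ σ)
    (hs : s ∈ Icc 0 T) : q s ≤ q 0 + K * (C * q 0 + 2 * E) := by
  have h₀ : 0 ∈ Icc 0 T := ⟨le_rfl, hs.1.trans hs.2⟩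
  have hvar := (le_abs_self _).trans (h.abs_sub_le 0 h₀ s hs)
  have hmono : ∫ t in (0 : ℝ)..s, w t ≤ ∫ t in (0 : ℝ)..T, w t :=
    integral_mono_interval_Icc h.integrableOn h.ae_nonneg le_rfl le_rfl hs.1 hs.2 le_rfl
  have hqT := mul_nonneg hσ (h.nonneg T ⟨h₀.2, le_rfl⟩)
  have htail : ∫ t in (0 : ℝ)..s, w t ≤ C * q 0 + 2 * E := by linarith [h.tail_le 0 h₀]
  linarith [mul_le_mul_of_nonneg_left htail hK]

theorem le_mul_integral (h : HasTailEstimate T K C σ E q w) (hK : 0 ≤ K) {r : ℝ} (hr : 0 ≤ r)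
    (hrs : r < s) (hs : s ≤ T) : q s ≤ (K + 1 / (s - r)) * ∫ t in r..s, w t := by
  have hpos : 0 < s - r := sub_pos.2 hrs
  have hint : IntervalIntegrable w volume r s := intervalIntegrable_of_integrableOn_Icc
    h.integrableOn ⟨hr, hrs.le.trans hs⟩ ⟨hr.trans hrs.le, hs⟩
  have hpointwise : ∀ t ∈ Icc r s, q s ≤ w t + K * ∫ τ in r..s, w τ := fun t ht => by
    have ht' : t ∈ Icc 0 T := ⟨hr.trans ht.1, ht.2.trans hs⟩
    have hvar := (le_abs_self _).trans (h.abs_sub_le t ht' s ⟨ht.2, hs⟩)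
    have hmono : ∫ τ in t..s, w τ ≤ ∫ τ in r..s, w τ :=
      integral_mono_interval_Icc h.integrableOn h.ae_nonneg hr ht.1 ht.2 le_rfl hs
    linarith [h.le t ht', mul_le_mul_of_nonneg_left hmono hK]
  have haverage := intervalIntegral.integral_mono_on hrs.le intervalIntegrable_const
    (hint.add intervalIntegrable_const) hpointwise
  rw [intervalIntegral.integral_add hint intervalIntegrable_const,
    intervalIntegral.integral_const, intervalIntegral.integral_const, smul_eq_mul,
    smul_eq_mul] at haverage
  refine le_of_mul_le_mul_left (haverage.trans_eq ?_) hpos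
  field_simp
  ring

theorem le_of_le_time (h : HasTailEstimate T K C σ E q w) (hK : 0 ≤ K) (hC : 0 < C) (hσ : 0 ≤ σ)
    {δ : ℝ} (hδ : 0 < δ) (hδs : δ ≤ s) (hs : s ≤ T) :
    q s ≤ (K + 1 / δ) * (C * (Real.exp (δ / C) * Real.exp (-(s / C))) * q 0 + 2 * E) := by
  have hr : 0 ≤ s - δ := sub_nonneg.2 hδs
  have hwindow := h.le_mul_integral hK hr (sub_lt_self s hδ) hs
  have hmono : ∫ t in (s - δ)..s, w t ≤ ∫ t in (s - δ)..T, w t :=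
    integral_mono_interval_Icc h.integrableOn h.ae_nonneg hr le_rfl (sub_le_self s hδ.le) hs le_rfl
  have hdecay := h.integral_add_le_exp hC (s := s - δ) ⟨hr, (sub_le_self s hδ.le).trans hs⟩
  have hqT := mul_nonneg hσ (h.nonneg T ⟨(hδ.le.trans hδs).trans hs, le_rfl⟩)
  rw [sub_sub_cancel] at hwindow
  rw [show -((s - δ) / C) = δ / C + -(s / C) by ring, Real.exp_add] at hdecay
  refine hwindow.trans ?_
  gcongr
  linarith

theorem le_of_window (h : HasTailEstimate T K C σ E q w) (hK : 0 ≤ K) (hC : 0 < C) (hσ : 0 ≤ σ)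
    (hE : 0 ≤ E) (hKC : q 0 ≤ K * C * q 0) {δ : ℝ} (hδ : 0 < δ) (hs : s ∈ Icc 0 T) :
    q s ≤ (2 * K + 2 / δ) * (Real.exp (δ / C) * C * Real.exp (-(s / C)) * q 0 + E) := by
  have hq₀ : 0 ≤ C * q 0 := mul_nonneg hC.le (h.nonneg 0 ⟨le_rfl, hs.1.trans hs.2⟩)
  rcases le_or_gt δ s with hδs | hsδ
  · calc q s ≤ _ := h.le_of_le_time hK hC hσ hδ hδs hs.2
      _ = (K + 1 / δ) * (Real.exp (δ / C) * Real.exp (-(s / C)) * (C * q 0) + 2 * E) := by ring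
      _ ≤ (K + 1 / δ) * (2 * (Real.exp (δ / C) * Real.exp (-(s / C)) * (C * q 0) + E)) := by
        have : 0 ≤ Real.exp (δ / C) * Real.exp (-(s / C)) * (C * q 0) := by positivity
        gcongr
        linarith
      _ = _ := by ring
  · have hexp : 1 ≤ Real.exp (δ / C) * Real.exp (-(s / C)) := by
      rw [← Real.exp_add, ← sub_eq_add_neg]
      exact Real.one_le_exp (sub_nonneg.2 (by gcongr))
    calc q s ≤ 2 * K * (C * q 0 + E) := by linarith [h.le_initial hK hσ hs]
      _ ≤ (2 * K + 2 / δ) * (Real.exp (δ / C) * Real.exp (-(s / C)) * (C * q 0) + E) :=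
        mul_le_mul (le_add_of_nonneg_right (by positivity))
          (add_le_add (le_mul_of_one_le_left hq₀ hexp) le_rfl) (by positivity) (by positivity)
      _ = _ := by ring

theorem le_of_short_window (h : HasTailEstimate T K C σ E q w) (hK : 0 ≤ K) (hC : 0 < C)
    (hσ : 0 ≤ σ) (hE : 0 ≤ E) {ρ : ℝ} (hρ : 0 < ρ) (hρC : 4 * ρ * q 0 ≤ C * q 0)
    (hs : s ∈ Icc 0 T) :
    q s ≤ (2 * K + 2 / ρ) * (C * Real.exp (-(s / C)) * q 0 + E) := by
  have hq₀ : 0 ≤ q 0 := h.nonneg 0 ⟨le_rfl, hs.1.trans hs.2⟩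
  have hexp : Real.exp (ρ / C) * q 0 ≤ 2 * q 0 := by
    rcases hq₀.eq_or_lt with hzero | hpos
    · simp [← hzero]
    have hρC' : ρ / C ≤ 1 / 4 := by
      rw [div_le_iff₀ hC]
      linarith [le_of_mul_le_mul_right hρC hpos]
    gcongr
    exact (Real.le_log_iff_exp_le two_pos).1 (by linarith [Real.log_two_gt_d9])
  rcases le_or_gt ρ s with hρs | hsρ
  · calc q s ≤ _ := h.le_of_le_time hK hC hσ hρ hρs hs.2
      _ = (K + 1 / ρ) * (C * Real.exp (-(s / C)) * (Real.exp (ρ / C) * q 0) + 2 * E) := by ring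
      _ ≤ (K + 1 / ρ) * (C * Real.exp (-(s / C)) * (2 * q 0) + 2 * E) := by gcongr
      _ = _ := by ring
  · have hq₀s : q 0 ≤ 2 * (Real.exp (-(s / C)) * q 0) := by
      calc q 0 ≤ Real.exp (-(s / C)) * (Real.exp (ρ / C) * q 0) := by
            rw [← mul_assoc, ← Real.exp_add, neg_add_eq_sub]
            exact le_mul_of_one_le_left hq₀ (Real.one_le_exp (sub_nonneg.2 (by gcongr)))
        _ ≤ Real.exp (-(s / C)) * (2 * q 0) := by gcongr
        _ = _ := by ring
    have hρq₀ : q 0 ≤ 2 / ρ * (C * Real.exp (-(s / C)) * q 0) := by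
      have hscaled := mul_le_mul_of_nonneg_left hρC (Real.exp_pos (-(s / C))).le
      rw [div_mul_eq_mul_div, le_div_iff₀ hρ]
      linarith [mul_le_mul_of_nonneg_right hq₀s hρ.le,
        mul_nonneg (mul_nonneg (Real.exp_pos (-(s / C))).le hq₀) hρ.le]
    have hKq₀ := mul_le_mul_of_nonneg_left hq₀s (mul_nonneg hK hC.le)
    have hρE : 0 ≤ 2 / ρ * E := by positivity
    linarith [h.le_initial hK hσ hs]

theorem le_min (h : HasTailEstimate T K C σ E q w) (hK : 0 ≤ K) (hC : 0 < C) (hσ : 0 ≤ σ)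
    (hE : 0 ≤ E) (hKC : q 0 ≤ K * C * q 0) {ρ δ : ℝ} (hρ : 0 < ρ) (hρC : 4 * ρ * q 0 ≤ C * q 0)
    (hδ : 0 < δ) (hs : s ∈ Icc 0 T) :
    q s ≤ (2 * K + min (2 / δ) (2 / ρ)) *
      (Real.exp (δ / C) * C * Real.exp (-(s / C)) * q 0 + E) := by
  rcases min_choice (2 / δ) (2 / ρ) with hmin | hmin <;> rw [hmin]
  · exact h.le_of_window hK hC hσ hE hKC hδ hs
  · have hq₀ : 0 ≤ q 0 := h.nonneg 0 ⟨le_rfl, hs.1.trans hs.2⟩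
    refine (h.le_of_short_window hK hC hσ hE hρ hρC hs).trans ?_
    gcongr
    exact le_mul_of_one_le_left hC.le (Real.one_le_exp (by positivity))

end HasTailEstimate

/-! ### Application to an approximate stationary point -/

section Application

variable {n m : ℕ} {F : Euc n × Euc m → Euc n} {L T ρ : ℝ} {x₀ : Euc n} {u p : ℝ → Euc m}
  {x : ℝ → Euc n} {Q : Euc n → ℝ} {R : Euc m → ℝ} {V : Euc n → ℝ}
  {αQ βQ αR βR αV βV γ Lx Lu ε : ℝ}

theorem IsSolution.abs_norm_sq_sub_le_integral_energyDensity {f : ℝ → Euc n → Euc n} {a b : ℝ}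
    {ξ : Euc n} (hx : IsSolution f a b ξ x) (hu : AdmissibleInput a b u) (hL : 0 ≤ L)
    (hρ : 0 < ρ) (hf : ∀ τ ∈ Icc a b, ‖f τ (x τ)‖ ≤ L * (‖x τ‖ + ‖u τ‖)) {s t : ℝ}
    (hs : s ∈ Icc a b) (ht : t ∈ Icc s b) :
    |‖x t‖ ^ 2 - ‖x s‖ ^ 2| ≤ L * (3 + 1 / ρ) * ∫ τ in s..t, energyDensity ρ x u τ := by
  have hsub : Icc s t ⊆ Icc a b := Icc_subset_Icc hs.1 ht.2
  have hxs := hx.continuousOn.mono hsub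
  have hus : AdmissibleInput s t u := hu.mono hsub
  refine (hx.abs_norm_sq_sub_le hu hL hf hs ⟨hs.1.trans ht.1, ht.2⟩ ht.1).trans ?_
  rw [mul_assoc, ← intervalIntegral.integral_const_mul (3 + 1 / ρ)]
  refine mul_le_mul_of_nonneg_left (intervalIntegral.integral_mono_on ht.1
    (intervalIntegrable_add_comp (Q := fun y : Euc n => 3 * ‖y‖ ^ 2)
      (R := fun w : Euc m => ‖w‖ ^ 2) (by fun_prop) (by fun_prop) hxs hus ht.1)
    ((intervalIntegrable_energyDensity hxs hus ht.1).const_mul _) fun τ _ => ?_) hL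
  calc 3 * ‖x τ‖ ^ 2 + ‖u τ‖ ^ 2
      ≤ 3 * ‖x τ‖ ^ 2 + ‖u τ‖ ^ 2 + (1 / ρ * ‖x τ‖ ^ 2 + 3 * ρ * ‖u τ‖ ^ 2) :=
        le_add_of_nonneg_right (by positivity)
    _ = (3 + 1 / ρ) * energyDensity ρ x u τ := by rw [energyDensity]; field_simp; ring

theorem IsSolution.mul_norm_sq_le {f : ℝ → Euc n → Euc n} {a b : ℝ} {ξ : Euc n}
    (hx : IsSolution f a b ξ x) (hu : AdmissibleInput a b u) (hL : 0 ≤ L)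
    (hf : ∀ τ ∈ Icc a b, ‖f τ (x τ)‖ ≤ L * (‖x τ‖ + ‖u τ‖)) (hab : a ≤ b) :
    (b - a) * ‖ξ‖ ^ 2 ≤ (1 + 4 * L * (b - a)) * ∫ t in a..b, (‖x t‖ ^ 2 + ‖u t‖ ^ 2) := by
  have hdensity : ∀ t, energyDensity 1 x u t = ‖x t‖ ^ 2 + ‖u t‖ ^ 2 := fun t => by
    rw [energyDensity, one_mul]
  simp only [← hdensity]
  have hint := intervalIntegrable_energyDensity (ρ := 1) hx.continuousOn hu hab
  have hpointwise : ∀ t ∈ Icc a b,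
      ‖ξ‖ ^ 2 - 4 * L * ∫ τ in a..b, energyDensity 1 x u τ ≤ energyDensity 1 x u t := fun t ht => by
    have hvar := (neg_le_abs _).trans (hx.abs_norm_sq_sub_le_integral_energyDensity hu hL one_pos hf
      (left_mem_Icc.2 hab) ht)
    have hmono : ∫ τ in a..t, energyDensity 1 x u τ ≤ ∫ τ in a..b, energyDensity 1 x u τ :=
      intervalIntegral.integral_mono_interval le_rfl ht.1 ht.2
        (Eventually.of_forall (energyDensity_nonneg zero_le_one)) hint
    rw [hx.eq_initial hab] at hvar
    linarith [norm_sq_le_energyDensity (x := x) (u := u) zero_le_one t,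
      mul_le_mul_of_nonneg_left hmono hL]
  have haverage := intervalIntegral.integral_mono_on hab intervalIntegrable_const hint hpointwise
  rw [intervalIntegral.integral_const, smul_eq_mul] at haverage
  linarith

theorem IsStabilizable.norm_sq_le_mul {A : ℝ → Euc n →L[ℝ] Euc n} {B : ℝ → Euc m →L[ℝ] Euc n}
    (h : IsStabilizable γ T A B) (hT : 0 ≤ T) (ξ : Euc n) : ‖ξ‖ ^ 2 ≤ γ * ‖ξ‖ ^ 2 := by
  refine le_of_forall_gt_imp_ge_of_dense fun c hc => ?_
  obtain ⟨v, z, -, hz, hlt⟩ := h.exists_lt (right_mem_Icc.2 hT) hc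
  rw [intervalIntegral.integral_same, zero_add, hz.eq_initial le_rfl] at hlt
  exact hlt.le

theorem IsStabilizable.mul_norm_sq_le {A : ℝ → Euc n →L[ℝ] Euc n} {B : ℝ → Euc m →L[ℝ] Euc n}
    (h : IsStabilizable γ T A B) (hL : 0 ≤ L) (hA : ∀ t ∈ Icc 0 T, ∀ y, ‖A t y‖ ≤ L * ‖y‖)
    (hB : ∀ t ∈ Icc 0 T, ∀ w, ‖B t w‖ ≤ L * ‖w‖) (hT : 0 ≤ T) (ξ : Euc n) :
    T * ‖ξ‖ ^ 2 ≤ (1 + 4 * L * T) * (γ * ‖ξ‖ ^ 2) := by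
  have hpos : 0 < 1 + 4 * L * T := by positivity
  rw [← div_le_iff₀' hpos]
  refine le_of_forall_gt_imp_ge_of_dense fun c hc => ?_
  obtain ⟨v, z, hv, hz, hlt⟩ := h.exists_lt (left_mem_Icc.2 hT) hc
  have hle := hz.mul_norm_sq_le hv hL (fun τ hτ => (norm_add_le _ _).trans
    ((add_le_add (hA τ hτ _) (hB τ hτ _)).trans_eq (mul_add _ _ _).symm)) hT
  rw [sub_zero] at hle
  rw [div_le_iff₀' hpos]
  refine hle.trans (mul_le_mul_of_nonneg_left ?_ hpos.le)
  linarith [sq_nonneg ‖z T‖]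

theorem IsStabilizable.norm_sq_le_twelve_mul {A : ℝ → Euc n →L[ℝ] Euc n}
    {B : ℝ → Euc m →L[ℝ] Euc n} (hγ : 0 < γ) (h : IsStabilizable γ (4 * γ) A B) (hL : 0 ≤ L)
    (hA : ∀ t ∈ Icc 0 (4 * γ), ∀ y, ‖A t y‖ ≤ L * ‖y‖)
    (hB : ∀ t ∈ Icc 0 (4 * γ), ∀ w, ‖B t w‖ ≤ L * ‖w‖) (ξ : Euc n) :
    ‖ξ‖ ^ 2 ≤ 12 * L * γ * ‖ξ‖ ^ 2 := by
  have hle := h.mul_norm_sq_le hL hA hB (by positivity) ξ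
  have hscaled : 3 * ‖ξ‖ ^ 2 ≤ 16 * L * γ * ‖ξ‖ ^ 2 := le_of_mul_le_mul_left (by linarith) hγ
  have hnonneg : 0 ≤ L * γ * ‖ξ‖ ^ 2 := by positivity
  linarith

theorem isTrajectory_zero (hF0 : F (0, 0) = 0) (T : ℝ) :
    IsTrajectory F T 0 (fun _ => 0) fun _ => 0 where
  continuousOn := continuousOn_const
  integrable := by simp [hF0]
  eq_integral := by simp [hF0]

theorem JointlyLipschitz.norm_le (hF : JointlyLipschitz L F) (hF0 : F (0, 0) = 0) (y : Euc n)
    (w : Euc m) : ‖F (y, w)‖ ≤ L * (‖y‖ + ‖w‖) := by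
  simpa [hF0] using hF y 0 w 0

theorem IsFOS.hasTailEstimate (hu : IsFOS T ε (cost F Q R V T x₀) u)
    (hx : IsTrajectory F T x₀ u x) (hFd : ContDiff ℝ 1 F) (hF : JointlyLipschitz L F)
    (hL : 0 ≤ L) (hF0 : F (0, 0) = 0) (hαQ : 0 < αQ) (hQ : IsCost αQ βQ Q) (hαR : 0 < αR)
    (hβR : 0 < βR) (hR : IsCost αR βR R) (hαV : 0 ≤ αV) (hV : IsCost αV βV V) (hγ : 0 ≤ γ)
    (hLu : Lu ^ 2 ≤ αR / (8 * βR)) (hLx : Lx ^ 2 ≤ αQ / (8 * βR))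
    (hstab : IsStabilizable γ T (fun t => jacA F (x t) (u t)) fun t => jacB F (x t) (u t))
    (hp : AdmissibleInput 0 T p)
    (hmatch : ∀ t ∈ Icc 0 T, jacB F (x t) (u t) (p t) = drift F (x t) (u t))
    (hpn : ∀ t ∈ Icc 0 T, ‖p t‖ ≤ Lx * ‖x t‖ + Lu * ‖u t‖) (hT : 0 ≤ T) :
    HasTailEstimate T (L * (3 + 1 / (αR / αQ))) (constC1 γ αQ βQ βR βV) (αV / αQ)
      (constC2 αQ αR βR Lx Lu * ε ^ 2) (fun t => ‖x t‖ ^ 2) (energyDensity (αR / αQ) x u) where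
  integrableOn := integrableOn_energyDensity hx.continuousOn hu.1 hT
  nonneg _ _ := sq_nonneg _
  le t _ := norm_sq_le_energyDensity (by positivity) t
  abs_sub_le _ ha _ hb := hx.abs_norm_sq_sub_le_integral_energyDensity hu.1 hL (by positivity)
    (fun _ _ => hF.norm_le hF0 _ _) ha hb
  tail_le _ hs := hu.integral_energyDensity_add_le hx hFd hF hL hαQ hQ hαR hβR hR hαV hV hγ hLu
    hLx hstab hp hmatch hpn hs

theorem twelve_mul_le_mul_constC1 (hL : 0 ≤ L) (hγ : 0 ≤ γ) (hαQ : 0 < αQ) (hαβQ : αQ ≤ βQ)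
    (hρ : 0 ≤ ρ) : 12 * L * γ ≤ L * (3 + 1 / ρ) * constC1 γ αQ βQ βR βV := by
  calc 12 * L * γ = L * 3 * (4 * γ) := by ring
    _ ≤ _ := by
      gcongr
      · exact le_add_of_nonneg_right (by positivity)
      · exact four_mul_le_constC1 hγ hαQ hαβQ

theorem constC0_eq (LF αQ αR αV : ℝ) :
    constC0 LF αQ αR αV = 2 * (LF * (3 + 1 / (αR / αQ)) + 1 / (αV / αQ)) := by
  rw [constC0, one_div_div, one_div_div]
  ring

theorem constC0δ_eq (LF αQ αR δ : ℝ) :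
    constC0δ LF αQ αR δ = 2 * (LF * (3 + 1 / (αR / αQ))) + min (2 / δ) (2 / (αR / αQ)) := by
  rw [constC0δ, one_div_div, div_div_eq_mul_div]
  ring

end Application

theorem mainTheorem1_general {n m : ℕ} {F : Euc n × Euc m → Euc n} {Q : Euc n → ℝ}
    {R : Euc m → ℝ} {V : Euc n → ℝ} {LF αQ βQ αR βR αV βV γ Lx Lu : ℝ} (hF : ContDiff ℝ 1 F)
    (hLF : 0 ≤ LF) (hFLip : JointlyLipschitz LF F) (hF0 : F (0, 0) = 0)
    (hαQ : 0 < αQ) (hαβQ : αQ ≤ βQ) (hQ : IsCost αQ βQ Q)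
    (hαR : 0 < αR) (hαβR : αR ≤ βR) (hR : IsCost αR βR R)
    (hαV : 0 ≤ αV) (hV : IsCost αV βV V) (hγ : 0 < γ)
    (hstab₀ : ∀ S : ℝ, 0 ≤ S →
      IsStabilizable γ S (fun _ => jacA F 0 0) fun _ => jacB F 0 0)
    (hLu : Lu ^ 2 ≤ αR / (8 * βR)) (hLx : Lx ^ 2 ≤ αQ / (8 * βR))
    {T : ℝ} (hT : 0 ≤ T) {x₀ : Euc n} {ε : ℝ} {u p : ℝ → Euc m} {x : ℝ → Euc n}
    (hu : IsFOS T ε (cost F Q R V T x₀) u) (hx : IsTrajectory F T x₀ u x)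
    (hstab : IsStabilizable γ T (fun t => jacA F (x t) (u t)) fun t => jacB F (x t) (u t))
    (hp : AdmissibleInput 0 T p)
    (hmatch : ∀ t ∈ Icc 0 T, jacB F (x t) (u t) (p t) = drift F (x t) (u t))
    (hpn : ∀ t ∈ Icc 0 T, ‖p t‖ ≤ Lx * ‖x t‖ + Lu * ‖u t‖) :
    (0 < αV → ∀ s ∈ Icc 0 T,
      ‖x s‖ ^ 2 ≤ constC0 LF αQ αR αV *
        (constC1 γ αQ βQ βR βV * Real.exp (-(s / constC1 γ αQ βQ βR βV)) * ‖x₀‖ ^ 2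
          + constC2 αQ αR βR Lx Lu * ε ^ 2)) ∧
    (∀ s ∈ Icc 0 T, ∀ δ : ℝ, 0 < δ →
      ‖x s‖ ^ 2 ≤ constC0δ LF αQ αR δ *
        (Real.exp (δ / constC1 γ αQ βQ βR βV) * constC1 γ αQ βQ βR βV
            * Real.exp (-(s / constC1 γ αQ βQ βR βV)) * ‖x₀‖ ^ 2
          + constC2 αQ αR βR Lx Lu * ε ^ 2)) := by
  have hβR : 0 < βR := hαR.trans_le hαβR
  have hC : 0 < constC1 γ αQ βQ βR βV := constC1_pos hγ hαQ hβR
  have hK : 0 ≤ LF * (3 + 1 / (αR / αQ)) := by positivity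
  have hE := mul_nonneg (constC2_nonneg (Lx := Lx) (Lu := Lu) hαQ.le hαR.le hβR.le) (sq_nonneg ε)
  have htail := hu.hasTailEstimate hx hF hFLip hLF hF0 hαQ hQ hαR hβR hR hαV hV hγ.le hLu hLx
    hstab hp hmatch hpn hT
  have hx₀ : x 0 = x₀ := hx.eq_initial hT
  rw [constC0_eq]
  simp only [constC0δ_eq, ← hx₀]
  refine ⟨fun hαV s hs => htail.le_of_terminal hK hC (div_pos hαV hαQ) hs, fun s hs δ hδ =>
    htail.le_min hK hC (by positivity) hE ?_ (div_pos hαR hαQ) ?_ hδ hs⟩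
  · exact ((hstab₀ (4 * γ) (by positivity)).norm_sq_le_twelve_mul hγ hLF
      (fun _ _ _ => hFLip.norm_jacA_apply_le hLF _ _ _)
      (fun _ _ _ => hFLip.norm_jacB_apply_le hLF _ _ _) _).trans
      (mul_le_mul_of_nonneg_right (twelve_mul_le_mul_constC1 hLF hγ.le hαQ hαβQ (by positivity))
        (sq_nonneg _))
  · calc 4 * (αR / αQ) * ‖x 0‖ ^ 2 ≤ 4 * (αR / αQ) * (γ * ‖x 0‖ ^ 2) :=
          mul_le_mul_of_nonneg_left (hstab.norm_sq_le_mul hT _) (by positivity)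
      _ = 4 * γ * (αR / αQ) * ‖x 0‖ ^ 2 := by ring
      _ ≤ _ := mul_le_mul_of_nonneg_right (four_mul_mul_div_le_constC1 hγ.le hαQ.le hαβR)
          (sq_nonneg _)

theorem mainTheorem1 {n m : ℕ} (F : Euc n × Euc m → Euc n)
    (Q : Euc n → ℝ) (R : Euc m → ℝ) (V : Euc n → ℝ)
    (LF αQ βQ αR βR αV βV γ Lx Lu : ℝ)
    -- regularity of the vector field, and the equilibrium at the origin
    (hF : ContDiff ℝ 1 F) (hLF : 0 < LF)
    (hFLip : ∀ x₁ x₂ u₁ u₂, ‖F (x₁, u₁) - F (x₂, u₂)‖ ≤ LF * (‖x₁ - x₂‖ + ‖u₁ - u₂‖))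
    (hF0 : F (0, 0) = 0)
    -- the costs
    (hαQ : 0 < αQ) (hαβQ : αQ ≤ βQ) (hQ : IsCost αQ βQ Q)
    (hαR : 0 < αR) (hαβR : αR ≤ βR) (hR : IsCost αR βR R)
    (hαV : 0 ≤ αV) (hαβV : αV ≤ βV) (hV : IsCost αV βV V)
    -- matching condition
    (hmatch : ∀ (T : ℝ) (x₀ : Euc n) (u : ℝ → Euc m) (x : ℝ → Euc n), 0 ≤ T →
      AdmissibleInput 0 T u → IsTrajectory F T x₀ u x →
      ∀ t ∈ Set.Icc 0 T, drift F (x t) (u t) ∈ Set.range (jacB F (x t) (u t)))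
    -- uniform stabilizability of the Jacobian linearizations
    (hγ : 0 < γ)
    (hstab : ∀ (T : ℝ) (x₀ : Euc n) (u : ℝ → Euc m) (x : ℝ → Euc n), 0 ≤ T →
      AdmissibleInput 0 T u → IsTrajectory F T x₀ u x →
      IsStabilizable γ T (fun t => jacA F (x t) (u t)) (fun t => jacB F (x t) (u t)))
    -- drift bound
    (hLx : 0 < Lx) (hLu : 0 < Lu)
    (hdrift : ∀ (T : ℝ) (x₀ : Euc n) (u : ℝ → Euc m) (x : ℝ → Euc n), 0 ≤ T →
      AdmissibleInput 0 T u → IsTrajectory F T x₀ u x →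
      ∀ t ∈ Set.Icc 0 T,
        ‖pinv (jacB F (x t) (u t)) (drift F (x t) (u t))‖ ≤ Lx * ‖x t‖ + Lu * ‖u t‖)
    -- smallness of the drift constants
    (hLu' : Lu ^ 2 ≤ αR / (8 * βR)) (hLx' : Lx ^ 2 ≤ αQ / (8 * βR))
    -- an approximate first-order stationary point and its trajectory
    (T : ℝ) (hT : 0 ≤ T) (x₀ : Euc n) (ε : ℝ) (u : ℝ → Euc m)
    (hu : IsFOS T ε (cost F Q R V T x₀) u)
    (x : ℝ → Euc n) (hx : IsTrajectory F T x₀ u x) :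
    (0 < αV → ∀ s ∈ Set.Icc 0 T,
      ‖x s‖ ^ 2 ≤ constC0 LF αQ αR αV *
        (constC1 γ αQ βQ βR βV * Real.exp (-(s / constC1 γ αQ βQ βR βV)) * ‖x₀‖ ^ 2
          + constC2 αQ αR βR Lx Lu * ε ^ 2)) ∧
    (∀ s ∈ Set.Icc 0 T, ∀ δ : ℝ, 0 < δ →
      ‖x s‖ ^ 2 ≤ constC0δ LF αQ αR δ *
        (Real.exp (δ / constC1 γ αQ βQ βR βV) * constC1 γ αQ βQ βR βV
            * Real.exp (-(s / constC1 γ αQ βQ βR βV)) * ‖x₀‖ ^ 2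
          + constC2 αQ αR βR Lx Lu * ε ^ 2)) :=
  mainTheorem1_general hF hLF.le hFLip hF0 hαQ hαβQ hQ hαR hαβR hR hαV hV hγ
    (fun S hS => hstab S 0 _ _ hS (MemLp.zero' (p := ∞)) (isTrajectory_zero hF0 S)) hLu' hLx' hT
    hu hx (hstab T x₀ u x hT hu.1 hx)
    (admissibleInput_pinv_drift hF hx.continuousOn hu.1 (hdrift T x₀ u x hT hu.1 hx))
    (fun t ht => apply_pinv_of_mem_range _ (hmatch T x₀ u x hT hu.1 hx t ht))
    (hdrift T x₀ u x hT hu.1 hx)
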